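/- Let $A$, $B$ be $W^*$-algebras. An $A$-$B$ $W^*$-correspondence is a self-dual right Hilbert $C^*$-module over $B$ with a unital normal $*$-homomorphism from $A$ into its adjointable operators; an $A$-$A$ $W^*$-correspondence $E$ is written $(E,A)$. Let $\overline{\otimes}$ denote the $W^*$-tensor product (the self-dual completion of the balanced interior tensor product). Let $(E,A)$ and $(F,B)$ be $W^*$-correspondences that are weakly Morita equivalent via $X$: $X$ is an $A$-$B$ $W^*$-equivalence bimodule (an $A$-$B$ $W^*$-correspondence, self-dual also as a left Hilbert $A$-module, with ${}_A\langle x,y\rangle z=x\langle y,z\rangle_B$ and with both inner products weak$^*$-full), and $W:E\overline{\otimes}_A X\to X\overline{\otimes}_B F$ is an isomorphism of $A$-$B$ $W^*$-correspondences. Let $\sigma:B\to B(H)$ be a normal $*$-representation on a Hilbert space $H$. Write $F\otimes_\sigma H$ for the Hilbert space completion of the algebraic tensor product under $\langle x\otimes h,y\otimes k\rangle=\langle h,\sigma(\langle x,y\rangle)k\rangle$, let $(F^\sigma)^*$ be the space of bounded operators $\eta^*:F\otimes_\sigma H\to H$ with $\eta^*(b\otimes I_H)=\sigma(b)\eta^*$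 for all $b\in B$, where $b\otimes I_H: x\otimes h\mapsto bx\otimes h$, and let $\mathbb D((F^\sigma)^*)$ be its open unit ball for the operator norm. Let $\sigma$-Covrep$F$ be the category whose objects are the points of $\mathbb D((F^\sigma)^*)$ and whose morphisms $\eta_1^*\to\eta_2^*$ are the biholomorphic automorphisms $g$ of $\mathbb D((F^\sigma)^*)$ with $g(\eta_1^*)=\eta_2^*$, with composition of maps. Let $\sigma^X:A\to B(X\otimes_\sigma H)$, $\sigma^X(a)(x\otimes h)=ax\otimes h$, be the induced representation, and define $\sigma^X$-Covrep$E$ in the same way from $\mathbb D((E^{\sigma^X})^*)$. Then $\sigma$-Covrep$F$ and $\sigma^X$-Covrep$E$ are equivalent categories. More precisely, there is an equivalence of categories $\mathscr F:\sigma\text{-Covrep}F\to\sigma^X\text{-Covrep}E$ which on objects is $$\eta^*\mapsto{\eta^*}^X:=(I_X\otimes\eta^*)(W\otimes I_H),$$ where $E\otimes_{\sigma^X}(X\otimes_\sigma H)$ is identified with $(E\overline{\otimes}_AX)\otimes_\sigma H$ and $(X\overline{\otimes}_BF)\otimes_\sigma H$ with $X\otimes(F\otimes_\sigma H)$ in the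 canonical way, and which maps a morphism $g$ to a morphism $\mathscr F(g)$ with $\mathscr F(g)({\zeta^*}^X)=(g(\zeta^*))^X$ for all $\zeta^*\in\mathbb D((F^\sigma)^*)$. -/

import Mathlib

open scoped TensorProduct RightActions

noncomputable section

namespace WStarMorita

open CategoryTheory

/-! ### Right Hilbert modules -/

/-- A right (pre-)Hilbert C⋆-module `E` over a C⋆-algebra `B`: the `B`-valued inner product is
conjugate linear in the first and linear in the second variable, and induces the norm of `E`.
(Mathlib's `CStarModule` is the notion for left actions.)  Completeness is required separately. -/
class RightHilbertModule (B E : Type*) [CStarAlgebra B] [PartialOrder B]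
    [NormedAddCommGroup E] [NormedSpace ℂ E] [Module Bᵐᵒᵖ E] where
  /-- the inner product -/
  ip : E → E → B
  ip_add_right : ∀ x y z, ip x (y + z) = ip x y + ip x z
  ip_smul_right : ∀ (c : ℂ) x y, ip x (c • y) = c • ip x y
  ip_op_smul_right : ∀ x y (b : B), ip x (y <• b) = ip x y * b
  star_ip : ∀ x y, star (ip x y) = ip y x
  ip_self_nonneg : ∀ x, 0 ≤ ip x x
  norm_sq_eq : ∀ x, ‖x‖ ^ 2 = ‖ip x x‖

open RightHilbertModule (ip)

section Basic

variable {B E : Type*} [CStarAlgebra B] [PartialOrder B]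
  [NormedAddCommGroup E] [NormedSpace ℂ E] [Module Bᵐᵒᵖ E] [RightHilbertModule B E]

lemma ip_add_right (x y z : E) : (ip x (y + z) : B) = ip x y + ip x z :=
  RightHilbertModule.ip_add_right x y z

lemma ip_smul_right (c : ℂ) (x y : E) : (ip x (c • y) : B) = c • ip x y :=
  RightHilbertModule.ip_smul_right c x y

lemma star_ip (x y : E) : star (ip x y : B) = ip y x := RightHilbertModule.star_ip x y

lemma ip_add_left (x y z : E) : (ip (x + y) z : B) = ip x z + ip y z := by
  rw [← star_ip z (x + y), ip_add_right, star_add, star_ip, star_ip]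

lemma ip_smul_left (c : ℂ) (x y : E) : (ip (c • x) y : B) = star c • ip x y := by
  rw [← star_ip y, ip_smul_right, star_smul, star_ip]

variable (B E) in
/-- The inner product as a sesquilinear map. -/
def ipₛₗ : E →ₗ⋆[ℂ] E →ₗ[ℂ] B :=
  LinearMap.mk₂'ₛₗ (starRingEnd ℂ) (RingHom.id ℂ) (fun x y => (ip x y : B))
    ip_add_left ip_smul_left ip_add_right ip_smul_right

lemma ip_sum_right {ι : Type*} (s : Finset ι) (x : E) (y : ι → E) :
    (ip x (∑ i ∈ s, y i) : B) = ∑ i ∈ s, ip x (y i) := map_sum (ipₛₗ B E x) y s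

lemma ip_sum_left {ι : Type*} (s : Finset ι) (x : ι → E) (y : E) :
    (ip (∑ i ∈ s, x i) y : B) = ∑ i ∈ s, ip (x i) y := by
  rw [← star_ip, ip_sum_right, star_sum]
  exact Finset.sum_congr rfl fun i _ => star_ip _ _

lemma ip_op_smul_right (x y : E) (b : B) : (ip x (y <• b) : B) = ip x y * b :=
  RightHilbertModule.ip_op_smul_right x y b

lemma ip_op_smul_left (x y : E) (b : B) : (ip (x <• b) y : B) = star b * ip x y := by
  rw [← star_ip, ip_op_smul_right, star_mul, star_ip]

variable (B) in
lemma ext_ip {x y : E} (h : ∀ z, (ip z x : B) = ip z y) : x = y := by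
  have h0 : (ip (x - y) (x - y) : B) = 0 := by
    have h1 := h (x - y)
    have h2 : (ip (x - y) (x - y) : B) = ip (x - y) x - ip (x - y) y :=
      map_sub (ipₛₗ B E (x - y)) x y
    rw [h2, h1, sub_self]
  have h3 := RightHilbertModule.norm_sq_eq (B := B) (x - y)
  rw [h0, norm_zero] at h3
  exact sub_eq_zero.mp (norm_eq_zero.mp (pow_eq_zero_iff (two_ne_zero) |>.mp h3))

/-- The decomposition of a self-adjoint element into its positive and negative part. -/
lemma exists_posPart_negPart {M : Type*} [NonUnitalCStarAlgebra M] [PartialOrder M]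
    [StarOrderedRing M] (m : M) (hm : IsSelfAdjoint m) :
    ∃ r s n : M, n = star s * s ∧ star n = n ∧ m = star r * r - n ∧ star r * r * n = 0 := by
  obtain ⟨s, hs⟩ := CStarAlgebra.nonneg_iff_eq_star_mul_self.mp (CFC.negPart_nonneg m)
  obtain ⟨r, hr⟩ := CStarAlgebra.nonneg_iff_eq_star_mul_self.mp (CFC.posPart_nonneg m)
  refine ⟨r, s, m⁻, hs, (CFC.negPart_nonneg m).isSelfAdjoint, ?_, ?_⟩
  · rw [← hr, CFC.posPart_sub_negPart m hm]
  · rw [← hr, CFC.posPart_mul_negPart m]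

/-- Gram matrices are positive: they are of the form `R⋆ R`. -/
lemma exists_gram_factor [StarOrderedRing B] {ι : Type*} [Fintype ι] (x : ι → E) :
    ∃ R : ι → ι → B, ∀ i j, (ip (x i) (x j) : B) = ∑ k, star (R k i) * R k j := by
  classical
  let M : CStarMatrix ι ι B := CStarMatrix.ofMatrix fun i j => ip (x i) (x j)
  have hMe : ∀ i j, M i j = ip (x i) (x j) := fun _ _ => rfl
  have hM : IsSelfAdjoint M := by
    ext i j
    rw [CStarMatrix.star_apply, hMe, hMe, star_ip]
  obtain ⟨R, S, N, hS, hNsa, hdec, hpn⟩ := exists_posPart_negPart M hM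
  have hNMN : N * M * N = -(N * N * N) := by
    have : M * N = -(N * N) := by rw [hdec, sub_mul, hpn, zero_sub]
    rw [mul_assoc, this, mul_neg, mul_assoc]
  have hcube : N * N * N = star (S * N) * (S * N) := by
    rw [star_mul, hNsa, mul_assoc N (star S), ← mul_assoc (star S), ← hS, mul_assoc]
  have hent : ∀ i j, star (N i j) = N j i := fun i j => by
    rw [← CStarMatrix.star_apply, hNsa]
  have hSN : S * N = 0 := by
    have key : ∀ k i, (S * N) i k = 0 := by
      intro k
      have h1 : (N * M * N) k k = ip (∑ j, x j <• N j k) (∑ j, x j <• N j k) := by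
        rw [ip_sum_left]
        simp only [ip_sum_right, ip_op_smul_left, ip_op_smul_right, CStarMatrix.mul_apply,
          Finset.sum_mul, hent, hMe]
        rw [Finset.sum_comm]
      have h2 : (N * N * N) k k = ∑ i, star ((S * N) i k) * (S * N) i k := by
        rw [hcube, CStarMatrix.mul_apply]
        simp [CStarMatrix.star_apply]
      have h3 : 0 ≤ (N * M * N) k k := by
        rw [h1]; exact RightHilbertModule.ip_self_nonneg _
      have h4 : 0 ≤ ∑ i, star ((S * N) i k) * (S * N) i k :=
        Finset.sum_nonneg fun i _ => star_mul_self_nonneg _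
      have h5 : ∑ i, star ((S * N) i k) * (S * N) i k = 0 := by
        refine le_antisymm ?_ h4
        rw [hNMN, CStarMatrix.neg_apply, h2] at h3
        exact neg_nonneg.mp h3
      intro i
      have h6 := (Finset.sum_eq_zero_iff_of_nonneg
        (fun i _ => star_mul_self_nonneg ((S * N) i k))).mp h5 i (Finset.mem_univ i)
      exact CStarRing.star_mul_self_eq_zero_iff _ |>.mp h6
    ext i k
    exact key k i
  have hNN : N * N = 0 := by
    rw [show N * N = star S * (S * N) by rw [← mul_assoc, ← hS], hSN, mul_zero]
  have hNz : N = 0 := by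
    have : star N * N = 0 := by rw [hNsa, hNN]
    exact CStarRing.star_mul_self_eq_zero_iff _ |>.mp this
  have hMR : M = star R * R := by rw [hdec, hNz, sub_zero]
  refine ⟨fun k j => R k j, fun i j => ?_⟩
  rw [← hMe, hMR, CStarMatrix.mul_apply]
  simp [CStarMatrix.star_apply]

end Basic

/-! ### W⋆-modules, W⋆-correspondences, W⋆-equivalence bimodules -/

/-- Self-duality: every bounded `B`-module map `E → B` is of the form `⟨y, ·⟩`. -/
def IsSelfDual (B E : Type*) [CStarAlgebra B] [PartialOrder B]
    [NormedAddCommGroup E] [NormedSpace ℂ E] [Module Bᵐᵒᵖ E] [RightHilbertModule B E] : Prop :=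
  ∀ f : E →L[ℂ] B, (∀ x (b : B), f (x <• b) = f x * b) → ∃ y, ∀ x, f x = ip y x

open scoped ComplexOrder in
/-- The normal positive functionals of a W⋆-algebra: the positive functionals that preserve the
suprema of bounded increasing nets.  Their linear span is the predual. -/
def NormalFunctional (B : Type*) [CStarAlgebra B] [PartialOrder B] : Type _ :=
  {ω : B →ₚ[ℂ] ℂ // ScottContinuous ω}

/-- The weak-⋆ (ultraweak) topology of a W⋆-algebra. -/
abbrev weakStarTopology (B : Type*) [CStarAlgebra B] [PartialOrder B] : TopologicalSpace B :=
  ⨅ ω : NormalFunctional B, TopologicalSpace.induced (fun b => ω.1 b) inferInstance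

/-- The weak-⋆ (ultraweak) topology of a W⋆-module, defined by the functionals
`x ↦ ω ⟨y, x⟩` with `y ∈ E` and `ω` normal. -/
abbrev moduleWeakStarTopology (B E : Type*) [CStarAlgebra B] [PartialOrder B]
    [NormedAddCommGroup E] [NormedSpace ℂ E] [Module Bᵐᵒᵖ E] [RightHilbertModule B E] :
    TopologicalSpace E :=
  ⨅ (ω : NormalFunctional B) (y : E),
    TopologicalSpace.induced (fun x => ω.1 (ip y x)) inferInstance

/-- An `A`-`B` W⋆-correspondence: a self-dual right Hilbert `B`-module `E` with a unital normal
⋆-homomorphism from `A` to the adjointable operators of `E`, written as a left action.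
Normality means that `a ↦ ⟨x, a x⟩` preserves suprema of bounded increasing nets for all `x`,
which is normality for the W⋆-algebra of adjointable operators. A W⋆-correspondence `(E, A)` is
an `A`-`A` W⋆-correspondence. -/
class WStarCorrespondence (A B E : Type*) [CStarAlgebra A] [PartialOrder A]
    [CStarAlgebra B] [PartialOrder B] [NormedAddCommGroup E] [NormedSpace ℂ E]
    [Module A E] [Module Bᵐᵒᵖ E] [RightHilbertModule B E] : Prop where
  complete : CompleteSpace E
  selfDual : IsSelfDual B E
  smul_smul_complex : ∀ (c : ℂ) (a : A) (x : E), (c • a) • x = c • (a • x)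
  ip_act_left : ∀ (a : A) (x y : E), (ip (a • x) y : B) = ip x (star a • y)
  normal : ∀ x : E, ScottContinuous fun a : A => (ip x (a • x) : B)

/-- The data turning an `A`-`B` W⋆-correspondence `X` into a W⋆-equivalence bimodule: an
`A`-valued inner product (linear in the first variable) for which `X` is a self-dual left Hilbert
`A`-module, compatible with the `B`-valued one, both inner products being weak-⋆ full. -/
structure EquivalenceBimodule (A B X : Type*) [CStarAlgebra A] [PartialOrder A]
    [CStarAlgebra B] [PartialOrder B] [NormedAddCommGroup X] [NormedSpace ℂ X]
    [Module A X] [Module Bᵐᵒᵖ X] [RightHilbertModule B X] [WStarCorrespondence A B X] where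
  /-- the `A`-valued inner product -/
  lip : X → X → A
  lip_add_left : ∀ x y z, lip (x + y) z = lip x z + lip y z
  lip_smul_left : ∀ (c : ℂ) x y, lip (c • x) y = c • lip x y
  lip_act_left : ∀ (a : A) x y, lip (a • x) y = a * lip x y
  star_lip : ∀ x y, star (lip x y) = lip y x
  lip_self_nonneg : ∀ x, 0 ≤ lip x x
  norm_sq_eq_lip : ∀ x, ‖x‖ ^ 2 = ‖lip x x‖
  lip_op_smul_left : ∀ x y (b : B), lip (x <• b) y = lip x (y <• star b)
  lip_smul : ∀ x y z, lip x y • z = x <• (ip y z : B)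
  left_selfDual : ∀ f : X →L[ℂ] A, (∀ (a : A) x, f (a • x) = a * f x) → ∃ y, ∀ x, f x = lip x y
  left_full : @Dense A (weakStarTopology A) (Submodule.span ℂ {a | ∃ x y, lip x y = a} : Set A)
  right_full : @Dense B (weakStarTopology B)
    (Submodule.span ℂ {b | ∃ x y : X, (ip x y : B) = b} : Set B)

/-- `IsWStarTensor C A B t` says that the `C`-`B` W⋆-correspondence `Z`, with `t e x` in the role of
`e ⊗ x`, is the W⋆-tensor product over `A` of a `C`-`A` W⋆-correspondence `E` and an `A`-`B`
W⋆-correspondence `X`, i.e. the self-dual completion of their balanced interior tensor product: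
the elementary tensors have the interior tensor inner product, and their span is weak-⋆ dense in
the self-dual module `Z`. This determines `(Z, t)` up to a unique isomorphism. -/
structure IsWStarTensor (C A B : Type*) {E X Z : Type*}
    [CStarAlgebra C] [PartialOrder C] [CStarAlgebra A] [PartialOrder A]
    [CStarAlgebra B] [PartialOrder B]
    [NormedAddCommGroup E] [NormedSpace ℂ E] [Module C E] [Module Aᵐᵒᵖ E]
    [RightHilbertModule A E] [WStarCorrespondence C A E]
    [NormedAddCommGroup X] [NormedSpace ℂ X] [Module A X] [Module Bᵐᵒᵖ X]
    [RightHilbertModule B X] [WStarCorrespondence A B X]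
    [NormedAddCommGroup Z] [NormedSpace ℂ Z] [Module C Z] [Module Bᵐᵒᵖ Z]
    [RightHilbertModule B Z] [WStarCorrespondence C B Z]
    (t : E →ₗ[ℂ] X →ₗ[ℂ] Z) : Prop where
  balanced : ∀ e (a : A) x, t (e <• a) x = t e (a • x)
  act_left : ∀ (c : C) e x, t (c • e) x = c • t e x
  act_right : ∀ e x (b : B), t e (x <• b) = t e x <• b
  ip_tmul : ∀ e e' x x', (ip (t e x) (t e' x') : B) = ip x ((ip e e' : A) • x')
  dense : @Dense Z (moduleWeakStarTopology B Z)
    (Submodule.span ℂ {z | ∃ e x, t e x = z} : Set Z)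

/-- Isomorphisms of `A`-`B` W⋆-correspondences: bijective bimodule maps preserving the inner
product. -/
structure CorrespondenceIso (A B Z₁ Z₂ : Type*) [CStarAlgebra A] [PartialOrder A]
    [CStarAlgebra B] [PartialOrder B]
    [NormedAddCommGroup Z₁] [NormedSpace ℂ Z₁] [Module A Z₁] [Module Bᵐᵒᵖ Z₁]
    [RightHilbertModule B Z₁]
    [NormedAddCommGroup Z₂] [NormedSpace ℂ Z₂] [Module A Z₂] [Module Bᵐᵒᵖ Z₂]
    [RightHilbertModule B Z₂] extends Z₁ ≃ₗ[ℂ] Z₂ where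
  map_act_left : ∀ (a : A) z, toFun (a • z) = a • toFun z
  map_act_right : ∀ (b : B) z, toFun (z <• b) = toFun z <• b
  map_ip : ∀ z z', (ip (toFun z) (toFun z') : B) = ip z z'

/-! ### The Hilbert space `E ⊗_σ H` -/

section Ind

variable {B E H : Type*} [CStarAlgebra B] [PartialOrder B]
  [NormedAddCommGroup E] [NormedSpace ℂ E] [Module Bᵐᵒᵖ E] [RightHilbertModule B E]
  [NormedAddCommGroup H] [InnerProductSpace ℂ H] [CompleteSpace H]

/-- The algebraic tensor product of a right Hilbert `B`-module `E` and the space `H` of a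
representation `σ` of `B`, to be equipped with the semi-inner product
`⟨x ⊗ h, y ⊗ k⟩ = ⟨h, σ ⟨x, y⟩ k⟩`. -/
@[nolint unusedArguments]
def IndPre (E : Type*) [NormedAddCommGroup E] [NormedSpace ℂ E]
    (σ : B →⋆ₙₐ[ℂ] (H →L[ℂ] H)) : Type _ := E ⊗[ℂ] H

instance (σ : B →⋆ₙₐ[ℂ] (H →L[ℂ] H)) : AddCommGroup (IndPre E σ) :=
  inferInstanceAs (AddCommGroup (E ⊗[ℂ] H))

instance (σ : B →⋆ₙₐ[ℂ] (H →L[ℂ] H)) : Module ℂ (IndPre E σ) :=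
  inferInstanceAs (Module ℂ (E ⊗[ℂ] H))

variable (σ : B →⋆ₙₐ[ℂ] (H →L[ℂ] H))

/-- The elementary tensors. -/
def preTmul : E →ₗ[ℂ] H →ₗ[ℂ] IndPre E σ := TensorProduct.mk ℂ E H

/-- Linear maps out of the algebraic tensor product. -/
def preLift {M : Type*} [AddCommGroup M] [Module ℂ M] (f : E →ₗ[ℂ] H →ₗ[ℂ] M) :
    IndPre E σ →ₗ[ℂ] M := TensorProduct.lift f

@[simp]
lemma preLift_tmul {M : Type*} [AddCommGroup M] [Module ℂ M] (f : E →ₗ[ℂ] H →ₗ[ℂ] M)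
    (x : E) (h : H) : preLift σ f (preTmul σ x h) = f x h := rfl

variable {σ} in
lemma pre_exists_sum (u : IndPre E σ) :
    ∃ (n : ℕ) (x : Fin n → E) (h : Fin n → H), u = ∑ i, preTmul σ (x i) (h i) :=
  TensorProduct.exists_sum_tmul_eq u

variable {σ} in
@[elab_as_elim]
lemma pre_induction {p : IndPre E σ → Prop} (u : IndPre E σ) (h0 : p 0)
    (ht : ∀ x h, p (preTmul σ x h)) (ha : ∀ u v, p u → p v → p (u + v)) : p u :=
  TensorProduct.induction_on u h0 ht ha

/-- The semi-inner product on the algebraic tensor product. -/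
def preForm : IndPre E σ →ₗ⋆[ℂ] IndPre E σ →ₗ[ℂ] ℂ :=
  TensorProduct.lift (LinearMap.mk₂'ₛₗ (starRingEnd ℂ) (starRingEnd ℂ)
    (fun (x : E) (h : H) => preLift σ (LinearMap.mk₂ ℂ
      (fun (y : E) (k : H) => inner ℂ h (σ (ip x y) k))
      (fun y y' k => by simp [ip_add_right])
      (fun c y k => by simp [ip_smul_right])
      (fun y k k' => by simp)
      (fun c y k => by simp)))
    (fun x x' h => by
      refine TensorProduct.ext' fun y k => ?_
      change inner ℂ h (σ (ip (x + x') y) k) = inner ℂ h (σ (ip x y) k) + inner ℂ h (σ (ip x' y) k)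
      simp [ip_add_left])
    (fun c x h => by
      refine TensorProduct.ext' fun y k => ?_
      change inner ℂ h (σ (ip (c • x) y) k) = star c * inner ℂ h (σ (ip x y) k)
      simp [ip_smul_left])
    (fun x h h' => by
      refine TensorProduct.ext' fun y k => ?_
      change inner ℂ (h + h') (σ (ip x y) k) = inner ℂ h (σ (ip x y) k) + inner ℂ h' (σ (ip x y) k)
      simp)
    (fun c x h => by
      refine TensorProduct.ext' fun y k => ?_
      change inner ℂ (c • h) (σ (ip x y) k) = star c * inner ℂ h (σ (ip x y) k)
      simp [mul_comm]))

@[simp]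
lemma preForm_tmul (x y : E) (h k : H) :
    preForm σ (preTmul σ x h) (preTmul σ y k) = inner ℂ h (σ (ip x y) k) := rfl

lemma preForm_conj (u v : IndPre E σ) : starRingEnd ℂ (preForm σ v u) = preForm σ u v := by
  induction u using pre_induction with
  | h0 => simp
  | ha u u' hu hu' => simp [hu, hu']
  | ht x h =>
    induction v using pre_induction with
    | h0 => simp
    | ha v v' hv hv' => simp [hv, hv']
    | ht y k =>
      rw [preForm_tmul, preForm_tmul, inner_conj_symm, ← star_ip y x, map_star,
        ContinuousLinearMap.star_eq_adjoint, ContinuousLinearMap.adjoint_inner_right]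

lemma preForm_sum_eq {n : ℕ} {x : Fin n → E} {R : Fin n → Fin n → B}
    (hR : ∀ i j, (ip (x i) (x j) : B) = ∑ k, star (R k i) * R k j) (h : Fin n → H) :
    preForm σ (∑ i, preTmul σ (x i) (h i)) (∑ i, preTmul σ (x i) (h i)) =
      ((∑ k, ‖∑ j, σ (R k j) (h j)‖ ^ 2 : ℝ) : ℂ) := by
  have h1 : ∀ k, ((‖∑ j, σ (R k j) (h j)‖ ^ 2 : ℝ) : ℂ) =
      inner ℂ (∑ j, σ (R k j) (h j)) (∑ j, σ (R k j) (h j)) := fun k => by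
    rw [inner_self_eq_norm_sq_to_K]; simp
  have h2 : ∀ i j k, inner ℂ (h i) (σ (star (R k i) * R k j) (h j)) =
      inner ℂ (σ (R k i) (h i)) (σ (R k j) (h j)) := fun i j k => by
    rw [map_mul, map_star, ContinuousLinearMap.star_eq_adjoint, ContinuousLinearMap.mul_def,
      ContinuousLinearMap.comp_apply, ContinuousLinearMap.adjoint_inner_right]
  have h3 : ∀ i j, inner ℂ (h i) (σ (ip (x i) (x j)) (h j)) =
      ∑ k, inner ℂ (σ (R k i) (h i)) (σ (R k j) (h j)) := fun i j => by
    rw [hR, map_sum, sum_apply, inner_sum]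
    exact Finset.sum_congr rfl fun k _ => h2 i j k
  rw [Complex.ofReal_sum]
  simp only [h1, sum_inner, inner_sum, map_sum, LinearMap.sum_apply, preForm_tmul, h3]
  rw [Finset.sum_comm]
  conv_lhs => enter [2, i]; rw [Finset.sum_comm]
  rw [Finset.sum_comm]
  refine Finset.sum_congr rfl fun i _ => ?_
  rw [Finset.sum_comm]

variable [StarOrderedRing B]

lemma preForm_self_nonneg (u : IndPre E σ) : 0 ≤ (preForm σ u u).re := by
  obtain ⟨n, x, h, rfl⟩ := pre_exists_sum u
  obtain ⟨R, hR⟩ := exists_gram_factor (B := B) x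
  rw [preForm_sum_eq σ hR h, Complex.ofReal_re]
  positivity

/-- The semi-inner product of the algebraic tensor product. -/
abbrev preCore : PreInnerProductSpace.Core ℂ (IndPre E σ) where
  inner u v := preForm σ u v
  conj_inner_symm u v := preForm_conj σ u v
  re_inner_nonneg u := preForm_self_nonneg σ u
  add_left u v w := by simp
  smul_left u v c := by simp

instance : SeminormedAddCommGroup (IndPre E σ) :=
  InnerProductSpace.Core.toSeminormedAddCommGroup (c := preCore σ)

instance : InnerProductSpace ℂ (IndPre E σ) := InnerProductSpace.ofCore (preCore σ)

lemma pre_inner_def (u v : IndPre E σ) : inner ℂ u v = preForm σ u v := rfl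

lemma pre_norm_sq (u : IndPre E σ) : ‖u‖ ^ 2 = (preForm σ u u).re :=
  (norm_sq_eq_re_inner (𝕜 := ℂ) u)

variable (E) in
/-- The Hilbert space `E ⊗_σ H`: the Hausdorff completion of the algebraic tensor product for
`⟨x ⊗ h, y ⊗ k⟩ = ⟨h, σ ⟨x, y⟩ k⟩`. -/
def Ind : Type _ := UniformSpace.Completion (IndPre E σ)

instance : NormedAddCommGroup (Ind E σ) :=
  inferInstanceAs (NormedAddCommGroup (UniformSpace.Completion (IndPre E σ)))

instance : InnerProductSpace ℂ (Ind E σ) :=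
  inferInstanceAs (InnerProductSpace ℂ (UniformSpace.Completion (IndPre E σ)))

instance : CompleteSpace (Ind E σ) :=
  inferInstanceAs (CompleteSpace (UniformSpace.Completion (IndPre E σ)))

variable (E) in
/-- The canonical map from the algebraic tensor product to its completion. -/
def toInd : IndPre E σ →ₗᵢ[ℂ] Ind E σ :=
  (UniformSpace.Completion.toComplₗᵢ : IndPre E σ →ₗᵢ[ℂ] UniformSpace.Completion (IndPre E σ))

lemma inner_toInd (u v : IndPre E σ) :
    inner ℂ (toInd E σ u) (toInd E σ v) = preForm σ u v :=
  UniformSpace.Completion.inner_coe u v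

variable {σ} in
@[elab_as_elim]
lemma ind_induction {p : Ind E σ → Prop} (ξ : Ind E σ) (hp : IsClosed {ξ | p ξ})
    (ih : ∀ u, p (toInd E σ u)) : p ξ :=
  UniformSpace.Completion.induction_on (α := IndPre E σ) ξ hp ih

variable {σ} in
@[elab_as_elim]
lemma ind_induction₂ {E' H' B' : Type*} [CStarAlgebra B'] [PartialOrder B'] [StarOrderedRing B']
    [NormedAddCommGroup E'] [NormedSpace ℂ E'] [Module B'ᵐᵒᵖ E'] [RightHilbertModule B' E']
    [NormedAddCommGroup H'] [InnerProductSpace ℂ H'] [CompleteSpace H']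
    {σ' : B' →⋆ₙₐ[ℂ] (H' →L[ℂ] H')} {p : Ind E σ → Ind E' σ' → Prop}
    (ξ : Ind E σ) (ζ : Ind E' σ') (hp : IsClosed {q : Ind E σ × Ind E' σ' | p q.1 q.2})
    (ih : ∀ u v, p (toInd E σ u) (toInd E' σ' v)) : p ξ ζ :=
  UniformSpace.Completion.induction_on₂ (α := IndPre E σ) (β := IndPre E' σ') ξ ζ hp ih

/-- The elementary tensor `x ⊗ h` in `E ⊗_σ H`. -/
def tmul (x : E) (h : H) : Ind E σ := toInd E σ (preTmul σ x h)

lemma inner_tmul_tmul (x y : E) (h k : H) :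
    inner ℂ (tmul σ x h) (tmul σ y k) = inner ℂ h (σ (ip x y) k) := by
  rw [tmul, tmul, inner_toInd, preForm_tmul]

/-- Continuous linear maps on `E ⊗_σ H` agreeing on elementary tensors are equal. -/
lemma ind_ext {M : Type*} [NormedAddCommGroup M] [NormedSpace ℂ M] {S T : Ind E σ →L[ℂ] M}
    (h : ∀ x k, S (tmul σ x k) = T (tmul σ x k)) : S = T := by
  ext v
  induction v using ind_induction with
  | hp => apply isClosed_eq <;> fun_prop
  | ih u =>
    induction u using pre_induction with
    | h0 => simp only [map_zero]
    | ht x k => exact h x k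
    | ha u v hu hv => simp only [map_add, hu, hv]

/-- The bounded operator on `E ⊗_σ H` determined by a bilinear map on `E × H`. -/
def indLift {M : Type*} [NormedAddCommGroup M] [NormedSpace ℂ M] [CompleteSpace M]
    (f : E →ₗ[ℂ] H →ₗ[ℂ] M) (C : ℝ) (hC : ∀ u, ‖preLift σ f u‖ ≤ C * ‖u‖) : Ind E σ →L[ℂ] M :=
  (((preLift σ f).mkContinuous C hC).fromCompletion :
    UniformSpace.Completion (IndPre E σ) →L[ℂ] M)

lemma indLift_toInd {M : Type*} [NormedAddCommGroup M] [NormedSpace ℂ M] [CompleteSpace M]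
    (f : E →ₗ[ℂ] H →ₗ[ℂ] M) (C : ℝ) (hC : ∀ u, ‖preLift σ f u‖ ≤ C * ‖u‖) (u : IndPre E σ) :
    indLift σ f C hC (toInd E σ u) = preLift σ f u :=
  ContinuousLinearMap.fromCompletion_apply_coe ((preLift σ f).mkContinuous C hC) u

@[simp]
lemma indLift_tmul {M : Type*} [NormedAddCommGroup M] [NormedSpace ℂ M] [CompleteSpace M]
    (f : E →ₗ[ℂ] H →ₗ[ℂ] M) (C : ℝ) (hC : ∀ u, ‖preLift σ f u‖ ≤ C * ‖u‖) (x : E) (h : H) :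
    indLift σ f C hC (tmul σ x h) = f x h := by
  rw [tmul, indLift_toInd, preLift_tmul]

lemma le_mul_of_sq {a b c : ℝ} (hb : 0 ≤ b) (hc : 0 ≤ c) (h : a ^ 2 ≤ c ^ 2 * b ^ 2) :
    a ≤ c * b := by
  rw [← mul_pow] at h
  exact le_of_sq_le_sq h (by positivity)

/-! #### The operator `I_E ⊗ η` -/

section IndMap

variable {K : Type*} [NormedAddCommGroup K] [InnerProductSpace ℂ K] [CompleteSpace K]
  {σ} {ρ : B →⋆ₙₐ[ℂ] (K →L[ℂ] K)}

/-- `x, h ↦ x ⊗ η h`. -/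
def indMapBilin (ρ : B →⋆ₙₐ[ℂ] (K →L[ℂ] K)) (η : H →L[ℂ] K) : E →ₗ[ℂ] H →ₗ[ℂ] Ind E ρ :=
  ((preTmul ρ).compr₂ (toInd E ρ).toLinearMap).compl₂ η.toLinearMap

lemma indMapBilin_apply (η : H →L[ℂ] K) (x : E) (h : H) :
    indMapBilin ρ η x h = tmul ρ x (η h) := rfl

variable (E) in
/-- The operator `I_E ⊗ η : E ⊗_σ H → E ⊗_ρ K` for an operator `η : H → K` that intertwines
`σ` and `ρ`; it is determined by `x ⊗ h ↦ x ⊗ η h`. -/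
def indMap (η : H →L[ℂ] K) (hη : ∀ b, η ∘L σ b = ρ b ∘L η) : Ind E σ →L[ℂ] Ind E ρ :=
  indLift σ (indMapBilin ρ η) ‖η‖ fun u => by
    obtain ⟨n, x, h, rfl⟩ := pre_exists_sum u
    obtain ⟨R, hR⟩ := exists_gram_factor (B := B) x
    have e1 : preLift σ (indMapBilin ρ η) (∑ i, preTmul σ (x i) (h i)) =
        toInd E ρ (∑ i, preTmul ρ (x i) (η (h i))) := by
      rw [map_sum, map_sum]
      exact Finset.sum_congr rfl fun i _ => rfl
    refine le_mul_of_sq (norm_nonneg _) (norm_nonneg _) ?_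
    rw [e1, LinearIsometry.norm_map, pre_norm_sq, pre_norm_sq, preForm_sum_eq ρ hR,
      preForm_sum_eq σ hR, Complex.ofReal_re, Complex.ofReal_re, Finset.mul_sum]
    refine Finset.sum_le_sum fun k _ => ?_
    have e2 : ∑ j, ρ (R k j) (η (h j)) = η (∑ j, σ (R k j) (h j)) := by
      rw [map_sum]
      exact Finset.sum_congr rfl fun j _ => (DFunLike.congr_fun (hη (R k j)) (h j)).symm
    rw [e2, ← mul_pow]
    gcongr
    exact η.le_opNorm _

@[simp]
lemma indMap_tmul (η : H →L[ℂ] K) (hη : ∀ b, η ∘L σ b = ρ b ∘L η) (x : E) (h : H) :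
    indMap E η hη (tmul σ x h) = tmul ρ x (η h) := by
  rw [indMap, indLift_tmul, indMapBilin_apply]

end IndMap

/-! #### Isometries out of `E ⊗_σ H` -/

/-- A bilinear map on `E × H` with the right inner products gives an isometry on `E ⊗_σ H`. -/
def indIsom {M : Type*} [NormedAddCommGroup M] [InnerProductSpace ℂ M] [CompleteSpace M]
    (f : E →ₗ[ℂ] H →ₗ[ℂ] M)
    (hf : ∀ x h y k, inner ℂ (f x h) (f y k) = inner ℂ h (σ (ip x y) k)) : Ind E σ →L[ℂ] M :=
  indLift σ f 1 fun u => by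
    have key : ∀ u v, inner ℂ (preLift σ f u) (preLift σ f v) = preForm σ u v := by
      intro u v
      induction u using pre_induction with
      | h0 => simp
      | ha u u' hu hu' => rw [map_add, inner_add_left, map_add, LinearMap.add_apply, hu, hu']
      | ht x h =>
        induction v using pre_induction with
        | h0 => simp
        | ha v v' hv hv' => rw [map_add, inner_add_right, map_add, hv, hv']
        | ht y k => exact hf x h y k
    refine le_mul_of_sq (norm_nonneg _) zero_le_one ?_
    rw [pre_norm_sq, norm_sq_eq_re_inner (𝕜 := ℂ), key, one_pow, one_mul]
    rfl

@[simp]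
lemma indIsom_tmul {M : Type*} [NormedAddCommGroup M] [InnerProductSpace ℂ M] [CompleteSpace M]
    (f : E →ₗ[ℂ] H →ₗ[ℂ] M)
    (hf : ∀ x h y k, inner ℂ (f x h) (f y k) = inner ℂ h (σ (ip x y) k)) (x : E) (h : H) :
    indIsom σ f hf (tmul σ x h) = f x h := indLift_tmul σ f 1 _ x h

end Ind

/-! ### The induced representation -/

section IndRep

variable {A B E H : Type*} [CStarAlgebra A] [PartialOrder A] [StarOrderedRing A]
  [CStarAlgebra B] [PartialOrder B] [StarOrderedRing B]
  [NormedAddCommGroup E] [NormedSpace ℂ E] [Module A E] [Module Bᵐᵒᵖ E]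
  [RightHilbertModule B E] [WStarCorrespondence A B E]
  [NormedAddCommGroup H] [InnerProductSpace ℂ H] [CompleteSpace H]

lemma act_smul_complex {A : Type*} (B : Type*) {E : Type*} [CStarAlgebra A] [PartialOrder A]
    [CStarAlgebra B] [PartialOrder B] [NormedAddCommGroup E] [NormedSpace ℂ E]
    [Module A E] [Module Bᵐᵒᵖ E] [RightHilbertModule B E] [WStarCorrespondence A B E]
    (a : A) (c : ℂ) (x : E) : a • (c • x) = c • (a • x) := by
  have hadj : ∀ (z y : E), (ip z (a • y) : B) = ip (star a • z) y := fun z y => by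
    rw [WStarCorrespondence.ip_act_left, star_star]
  refine ext_ip B fun z => ?_
  rw [hadj, ip_smul_right, ip_smul_right, hadj]

/-- The operator `x ↦ a x` of the left action. -/
def actLin {A : Type*} (B E : Type*) [CStarAlgebra A] [PartialOrder A]
    [CStarAlgebra B] [PartialOrder B] [NormedAddCommGroup E] [NormedSpace ℂ E]
    [Module A E] [Module Bᵐᵒᵖ E] [RightHilbertModule B E] [WStarCorrespondence A B E]
    (a : A) : E →ₗ[ℂ] E where
  toFun x := a • x
  map_add' x y := smul_add a x y
  map_smul' c x := act_smul_complex B a c x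

variable (σ : B →⋆ₙₐ[ℂ] (H →L[ℂ] H))

/-- `x ⊗ h ↦ a x ⊗ h` on the algebraic tensor product. -/
def preAct (a : A) : IndPre E σ →ₗ[ℂ] IndPre E σ :=
  preLift σ ((preTmul σ).comp (actLin B E a))

@[simp]
lemma preAct_tmul (a : A) (x : E) (h : H) :
    preAct σ a (preTmul σ x h) = preTmul σ (a • x) h := rfl

lemma preForm_preAct (a : A) (u v : IndPre E σ) :
    preForm σ (preAct σ a u) v = preForm σ u (preAct σ (star a) v) := by
  induction u using pre_induction with
  | h0 => simp
  | ha u u' hu hu' => simp [hu, hu']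
  | ht x h =>
    induction v using pre_induction with
    | h0 => simp
    | ha v v' hv hv' => rw [map_add, map_add, map_add, hv, hv']
    | ht y k =>
      rw [preAct_tmul, preAct_tmul, preForm_tmul, preForm_tmul, WStarCorrespondence.ip_act_left]

lemma preAct_mul (a b : A) (u : IndPre E σ) :
    preAct σ (a * b) u = preAct σ a (preAct σ b u) := by
  induction u using pre_induction with
  | h0 => simp
  | ha u u' hu hu' => simp [hu, hu']
  | ht x h => simp [mul_smul]

lemma preAct_sub (a b : A) (u : IndPre E σ) :
    preAct σ (a - b) u = preAct σ a u - preAct σ b u := by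
  induction u using pre_induction with
  | h0 => simp
  | ha u u' hu hu' => simp [hu, hu']; abel
  | ht x h => simp [sub_smul]

lemma preAct_algebraMap (c : ℂ) (u : IndPre E σ) :
    preAct σ (algebraMap ℂ A c) u = c • u := by
  induction u using pre_induction with
  | h0 => simp
  | ha u u' hu hu' => simp [hu, hu']
  | ht x h =>
    rw [preAct_tmul, Algebra.algebraMap_eq_smul_one, WStarCorrespondence.smul_smul_complex (B := B),
      one_smul, map_smul, LinearMap.smul_apply]

lemma norm_preAct_le (a : A) (u : IndPre E σ) : ‖preAct σ a u‖ ≤ ‖a‖ * ‖u‖ := by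
  refine le_mul_of_sq (norm_nonneg _) (norm_nonneg _) ?_
  have h1 : star a * a ≤ algebraMap ℝ A (‖a‖ ^ 2) := CStarAlgebra.star_mul_le_algebraMap_norm_sq
  obtain ⟨c, hc⟩ := CStarAlgebra.nonneg_iff_eq_star_mul_self.mp (sub_nonneg.mpr h1)
  have h2 := preForm_self_nonneg σ (preAct σ c u)
  rw [preForm_preAct, ← preAct_mul, ← hc, preAct_sub, preAct_mul, map_sub, ← preForm_preAct,
    IsScalarTower.algebraMap_apply ℝ ℂ A, preAct_algebraMap, map_smul, Complex.sub_re,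
    ← pre_norm_sq] at h2
  rw [pre_norm_sq σ u]
  have h3 : (algebraMap ℝ ℂ (‖a‖ ^ 2) • preForm σ u u).re = ‖a‖ ^ 2 * (preForm σ u u).re := by
    rw [Complex.coe_algebraMap, smul_eq_mul, Complex.re_ofReal_mul]
  rw [h3] at h2
  exact sub_nonneg.mp h2

/-- `x, h ↦ a x ⊗ h`. -/
def actBilin (a : A) : E →ₗ[ℂ] H →ₗ[ℂ] Ind E σ :=
  (indMapBilin σ (ContinuousLinearMap.id ℂ H)).comp (actLin B E a)

lemma actBilin_apply (a : A) (x : E) (h : H) : actBilin σ a x h = tmul σ (a • x) h := rfl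

/-- The operator `a ⊗ I` on `E ⊗_σ H`. -/
def indAct (a : A) : Ind E σ →L[ℂ] Ind E σ :=
  indLift σ (actBilin σ a) ‖a‖ fun u => by
    have : preLift σ (actBilin σ a) u = toInd E σ (preAct σ a u) := by
      induction u using pre_induction with
      | h0 => simp only [map_zero]
      | ha u u' hu hu' => simp only [map_add, hu, hu']
      | ht x h => rfl
    rw [this, LinearIsometry.norm_map]
    exact norm_preAct_le σ a u

@[simp]
lemma indAct_tmul (a : A) (x : E) (h : H) : indAct σ a (tmul σ x h) = tmul σ (a • x) h := by
  rw [indAct, indLift_tmul, actBilin_apply]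

lemma tmul_add_left (x y : E) (h : H) : tmul σ (x + y) h = tmul σ x h + tmul σ y h := by
  simp [tmul]

lemma tmul_smul_left (c : ℂ) (x : E) (h : H) : tmul σ (c • x) h = c • tmul σ x h := by
  simp [tmul]

variable (A E) in
/-- The induced representation `σ^E ∘ φ` of `A` on `E ⊗_σ H`, `a ↦ a ⊗ I`, i.e.
`a ⊗ I : x ⊗ h ↦ a x ⊗ h`. -/
def indRep : A →⋆ₙₐ[ℂ] (Ind E σ →L[ℂ] Ind E σ) where
  toFun := indAct σ
  map_smul' c a := ind_ext σ fun x h => by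
    simp [WStarCorrespondence.smul_smul_complex (B := B), tmul_smul_left]
  map_zero' := ind_ext σ fun x h => by
    rw [indAct_tmul, zero_smul, tmul, map_zero, LinearMap.zero_apply,
      map_zero, zero_apply]
  map_add' a b := ind_ext σ fun x h => by
    simp [add_smul, tmul_add_left]
  map_mul' a b := ind_ext σ fun x h => by
    simp [mul_smul]
  map_star' a := by
    refine (ContinuousLinearMap.eq_adjoint_iff _ _).mpr fun u v => ?_
    induction u, v using ind_induction₂ with
    | hp =>
      exact isClosed_eq (((indAct σ (star a)).continuous.comp continuous_fst).inner continuous_snd)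
        (continuous_fst.inner ((indAct σ a).continuous.comp continuous_snd))
    | ih u v =>
      induction u using pre_induction with
      | h0 => simp only [map_zero, inner_zero_left]
      | ha u u' hu hu' => simp only [map_add, inner_add_left, hu, hu']
      | ht x h =>
        induction v using pre_induction with
        | h0 => simp only [map_zero, inner_zero_right]
        | ha v v' hv hv' =>
          simp only [map_add, inner_add_right, hv, hv']
        | ht y k =>
          change inner ℂ (indAct σ (star a) (tmul σ x h)) (tmul σ y k) =
            inner ℂ (tmul σ x h) (indAct σ a (tmul σ y k))
          rw [indAct_tmul, indAct_tmul, inner_tmul_tmul, inner_tmul_tmul,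
            WStarCorrespondence.ip_act_left, star_star]

@[simp]
lemma indRep_tmul (a : A) (x : E) (h : H) :
    indRep A E σ a (tmul σ x h) = tmul σ (a • x) h := indAct_tmul σ a x h

end IndRep

/-! ### The intertwining space and its disc -/

/-- The intertwining space `(E^σ)^*`, for a W⋆-correspondence `(E, A)` and a representation `σ`
of `A`: the operators `η^* : E ⊗_σ H → H` with `η^* (a ⊗ I) = σ(a) η^*` for all `a`. -/
def intertwiners {A : Type*} (E : Type*) {H : Type*} [CStarAlgebra A] [PartialOrder A]
    [StarOrderedRing A] [NormedAddCommGroup E] [NormedSpace ℂ E] [Module A E]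
    [Module Aᵐᵒᵖ E] [RightHilbertModule A E] [WStarCorrespondence A A E]
    [NormedAddCommGroup H] [InnerProductSpace ℂ H] [CompleteSpace H]
    (σ : A →⋆ₙₐ[ℂ] (H →L[ℂ] H)) : Submodule ℂ (Ind E σ →L[ℂ] H) where
  carrier := {η | ∀ a, η ∘L indRep A E σ a = σ a ∘L η}
  zero_mem' a := by simp
  add_mem' hη hζ a := by
    rw [ContinuousLinearMap.add_comp, ContinuousLinearMap.comp_add, hη a, hζ a]
  smul_mem' c η hη a := by
    rw [ContinuousLinearMap.smul_comp, ContinuousLinearMap.comp_smul, hη a]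

section Disc

variable (V : Type*) [NormedAddCommGroup V] [NormedSpace ℂ V]

/-- The open unit disc of a normed space. -/
abbrev Disc : Set V := Metric.ball (0 : V) 1

variable {V} in
/-- A self-map of the open unit disc is holomorphic if it is complex (Fréchet) differentiable at
every point of the disc. -/
def IsHolomorphic (g : Disc V → Disc V) : Prop :=
  ∃ G : V → V, DifferentiableOn ℂ G (Disc V) ∧ ∀ p : Disc V, G p = g p

/-- The group of biholomorphic automorphisms of the open unit disc. -/
def discAut : Subgroup (Equiv.Perm (Disc V)) where
  carrier := {g | IsHolomorphic g ∧ IsHolomorphic g.symm}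
  one_mem' := by
    have : IsHolomorphic (fun p : Disc V => p) := ⟨id, differentiableOn_id, fun _ => rfl⟩
    exact ⟨this, this⟩
  mul_mem' := by
    have comp : ∀ f g : Disc V → Disc V, IsHolomorphic f → IsHolomorphic g →
        IsHolomorphic (f ∘ g) := by
      rintro f g ⟨F, hF, hFf⟩ ⟨G, hG, hGg⟩
      refine ⟨F ∘ G, hF.comp hG fun v hv => ?_, fun p => ?_⟩
      · have := hGg ⟨v, hv⟩
        simp only at this
        rw [this]
        exact (g ⟨v, hv⟩).2
      · rw [Function.comp_apply, hGg, hFf, Function.comp_apply]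
    rintro f g ⟨hf, hf'⟩ ⟨hg, hg'⟩
    exact ⟨comp f g hf hg, comp g.symm f.symm hg' hf'⟩
  inv_mem' := fun h => ⟨h.2, h.1⟩

/-- The category whose objects are the points of the open unit disc of `V` and whose morphisms
are the biholomorphic automorphisms of the disc carrying one point to another. -/
structure DiscCat where
  /-- the point of the disc -/
  pt : Disc V

/-- Morphisms `p ⟶ q`: the automorphisms `g` of the disc with `g p = q`. -/
@[ext]
structure DiscCat.Hom {V : Type*} [NormedAddCommGroup V] [NormedSpace ℂ V] (p q : DiscCat V) where
  /-- the automorphism of the disc -/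
  aut : discAut V
  map_pt : aut.1 p.pt = q.pt

instance : Category (DiscCat V) where
  Hom p q := DiscCat.Hom p q
  id p := ⟨1, rfl⟩
  comp f g := ⟨g.aut * f.aut, by
    rw [← g.map_pt, ← f.map_pt]; rfl⟩
  id_comp f := DiscCat.Hom.ext (mul_one _)
  comp_id f := DiscCat.Hom.ext (one_mul _)
  assoc f g h := DiscCat.Hom.ext (mul_assoc _ _ _).symm

end Disc

section Covrep

variable {A : Type*} (E : Type*) {H : Type*} [CStarAlgebra A] [PartialOrder A]
  [StarOrderedRing A] [NormedAddCommGroup E] [NormedSpace ℂ E] [Module A E]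
  [Module Aᵐᵒᵖ E] [RightHilbertModule A E] [WStarCorrespondence A A E]
  [NormedAddCommGroup H] [InnerProductSpace ℂ H] [CompleteSpace H]
  (σ : A →⋆ₙₐ[ℂ] (H →L[ℂ] H))

/-- The category `σ-Covrep E`: its objects are the points of the open unit disc of `(E^σ)^*`
(for the operator norm), its morphisms the automorphisms of that disc carrying one point to
another. -/
abbrev Covrep : Type _ := DiscCat (intertwiners E σ)

end Covrep

/-! ### The transform `η^* ↦ (I_X ⊗ η^*)(W ⊗ I_H)` -/

section Transform

variable {C A B E X Z H : Type*}
  [CStarAlgebra C] [PartialOrder C] [StarOrderedRing C]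
  [CStarAlgebra A] [PartialOrder A] [StarOrderedRing A]
  [CStarAlgebra B] [PartialOrder B] [StarOrderedRing B]
  [NormedAddCommGroup E] [NormedSpace ℂ E] [Module C E] [Module Aᵐᵒᵖ E]
  [RightHilbertModule A E] [WStarCorrespondence C A E]
  [NormedAddCommGroup X] [NormedSpace ℂ X] [Module A X] [Module Bᵐᵒᵖ X]
  [RightHilbertModule B X] [WStarCorrespondence A B X]
  [NormedAddCommGroup Z] [NormedSpace ℂ Z] [Module C Z] [Module Bᵐᵒᵖ Z]
  [RightHilbertModule B Z] [WStarCorrespondence C B Z]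
  [NormedAddCommGroup H] [InnerProductSpace ℂ H] [CompleteSpace H]

/-- `x, h ↦ t e x ⊗ h`. -/
def assocBilin (t : E →ₗ[ℂ] X →ₗ[ℂ] Z) (σ : B →⋆ₙₐ[ℂ] (H →L[ℂ] H)) (e : E) :
    X →ₗ[ℂ] H →ₗ[ℂ] Ind Z σ :=
  (indMapBilin σ (ContinuousLinearMap.id ℂ H)).comp (t e)

lemma assocBilin_apply (t : E →ₗ[ℂ] X →ₗ[ℂ] Z) (σ : B →⋆ₙₐ[ℂ] (H →L[ℂ] H)) (e : E)
    (x : X) (h : H) : assocBilin t σ e x h = tmul σ (t e x) h := rfl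

lemma inner_assocBilin {t : E →ₗ[ℂ] X →ₗ[ℂ] Z} (ht : IsWStarTensor C A B t)
    (σ : B →⋆ₙₐ[ℂ] (H →L[ℂ] H)) (e e' : E) (u v : IndPre X σ) :
    inner ℂ (preLift σ (assocBilin t σ e) u) (preLift σ (assocBilin t σ e') v) =
      inner ℂ (toInd X σ u) (indRep A X σ (ip e e') (toInd X σ v)) := by
  induction u using pre_induction with
  | h0 => simp only [map_zero, inner_zero_left]
  | ha u u' hu hu' =>
    simp only [map_add, inner_add_left, hu, hu']
  | ht x h =>
    induction v using pre_induction with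
    | h0 =>
      simp only [map_zero, inner_zero_right]
    | ha v v' hv hv' =>
      simp only [map_add, inner_add_right, hv, hv']
    | ht y k =>
      rw [preLift_tmul, preLift_tmul, assocBilin_apply, assocBilin_apply, inner_tmul_tmul,
        ht.ip_tmul]
      change _ = inner ℂ (tmul σ x h) (indRep A X σ (ip e e') (tmul σ y k))
      rw [indRep_tmul, inner_tmul_tmul]

/-- The operator `X ⊗_σ H → Z ⊗_σ H`, `x ⊗ h ↦ (e ⊗ x) ⊗ h`. -/
def assocOp {t : E →ₗ[ℂ] X →ₗ[ℂ] Z} (ht : IsWStarTensor C A B t)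
    (σ : B →⋆ₙₐ[ℂ] (H →L[ℂ] H)) (e : E) : Ind X σ →L[ℂ] Ind Z σ :=
  indLift σ (assocBilin t σ e) √‖indRep A X σ (ip e e)‖ fun u => by
    refine le_mul_of_sq (norm_nonneg _) (Real.sqrt_nonneg _) ?_
    rw [Real.sq_sqrt (norm_nonneg _), norm_sq_eq_re_inner (𝕜 := ℂ), inner_assocBilin ht]
    refine (Complex.re_le_norm _).trans ((norm_inner_le_norm _ _).trans ?_)
    have := (indRep A X σ (ip e e)).le_opNorm (toInd X σ u)
    rw [LinearIsometry.norm_map] at this ⊢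
    nlinarith [norm_nonneg u]

@[simp]
lemma assocOp_tmul {t : E →ₗ[ℂ] X →ₗ[ℂ] Z} (ht : IsWStarTensor C A B t)
    (σ : B →⋆ₙₐ[ℂ] (H →L[ℂ] H)) (e : E) (x : X) (h : H) :
    assocOp ht σ e (tmul σ x h) = tmul σ (t e x) h := by
  rw [assocOp, indLift_tmul, assocBilin_apply]

lemma inner_assocOp {t : E →ₗ[ℂ] X →ₗ[ℂ] Z} (ht : IsWStarTensor C A B t)
    (σ : B →⋆ₙₐ[ℂ] (H →L[ℂ] H)) (e e' : E) (ξ ζ : Ind X σ) :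
    inner ℂ (assocOp ht σ e ξ) (assocOp ht σ e' ζ) = inner ℂ ξ (indRep A X σ (ip e e') ζ) := by
  induction ξ, ζ using ind_induction₂ with
  | hp =>
    exact isClosed_eq (((assocOp ht σ e).continuous.comp continuous_fst).inner
        ((assocOp ht σ e').continuous.comp continuous_snd))
      (continuous_fst.inner ((indRep A X σ (ip e e')).continuous.comp continuous_snd))
  | ih u v =>
    rw [← inner_assocBilin ht, assocOp, assocOp, indLift_toInd, indLift_toInd]

/-- `e, ξ ↦ (x ⊗ h ↦ (e ⊗ x) ⊗ h) ξ`. -/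
def assocOpBilin {t : E →ₗ[ℂ] X →ₗ[ℂ] Z} (ht : IsWStarTensor C A B t)
    (σ : B →⋆ₙₐ[ℂ] (H →L[ℂ] H)) : E →ₗ[ℂ] Ind X σ →ₗ[ℂ] Ind Z σ :=
  LinearMap.mk₂ ℂ (fun e ξ => assocOp ht σ e ξ)
    (fun e e' ξ => DFunLike.congr_fun (ind_ext σ (S := assocOp ht σ (e + e'))
      (T := assocOp ht σ e + assocOp ht σ e') fun x h => by simp [tmul_add_left]) ξ)
    (fun c e ξ => DFunLike.congr_fun (ind_ext σ (S := assocOp ht σ (c • e))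
      (T := c • assocOp ht σ e) fun x h => by simp [tmul_smul_left]) ξ)
    (fun e ξ ζ => map_add _ ξ ζ)
    (fun c e ξ => map_smul _ c ξ)

lemma assocOpBilin_apply {t : E →ₗ[ℂ] X →ₗ[ℂ] Z} (ht : IsWStarTensor C A B t)
    (σ : B →⋆ₙₐ[ℂ] (H →L[ℂ] H)) (e : E) (ξ : Ind X σ) :
    assocOpBilin ht σ e ξ = assocOp ht σ e ξ := rfl

/-- The canonical isometry `E ⊗ (X ⊗_σ H) → (E ⊗ X) ⊗_σ H`, `e ⊗ (x ⊗ h) ↦ (e ⊗ x) ⊗ h`,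
where `E ⊗ X = Z` is the W⋆-tensor product. It is a unitary when `σ` is normal. -/
def assocIsom {t : E →ₗ[ℂ] X →ₗ[ℂ] Z} (ht : IsWStarTensor C A B t)
    (σ : B →⋆ₙₐ[ℂ] (H →L[ℂ] H)) : Ind E (indRep A X σ) →L[ℂ] Ind Z σ :=
  indIsom (indRep A X σ) (assocOpBilin ht σ) fun e ξ e' ζ => by
    rw [assocOpBilin_apply, assocOpBilin_apply, inner_assocOp ht σ e e' ξ ζ]

lemma assocIsom_tmul {t : E →ₗ[ℂ] X →ₗ[ℂ] Z} (ht : IsWStarTensor C A B t)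
    (σ : B →⋆ₙₐ[ℂ] (H →L[ℂ] H)) (e : E) (x : X) (h : H) :
    assocIsom ht σ (tmul (indRep A X σ) e (tmul σ x h)) = tmul σ (t e x) h := by
  exact (indIsom_tmul (indRep A X σ) (assocOpBilin ht σ) _ e (tmul σ x h)).trans
    (assocOp_tmul ht σ e x h)

/-- The operator `W ⊗ I_H : Z₁ ⊗_σ H → Z₂ ⊗_σ H`, `z ⊗ h ↦ W z ⊗ h`. -/
def isoTensorId {Z₁ Z₂ : Type*}
    [NormedAddCommGroup Z₁] [NormedSpace ℂ Z₁] [Module A Z₁] [Module Bᵐᵒᵖ Z₁]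
    [RightHilbertModule B Z₁]
    [NormedAddCommGroup Z₂] [NormedSpace ℂ Z₂] [Module A Z₂] [Module Bᵐᵒᵖ Z₂]
    [RightHilbertModule B Z₂]
    (W : CorrespondenceIso A B Z₁ Z₂) (σ : B →⋆ₙₐ[ℂ] (H →L[ℂ] H)) : Ind Z₁ σ →L[ℂ] Ind Z₂ σ :=
  indIsom σ ((indMapBilin σ (ContinuousLinearMap.id ℂ H)).comp W.toLinearEquiv.toLinearMap)
    fun z h z' k => by
      have hW : ∀ (z : Z₁) (h : H), ((indMapBilin σ (ContinuousLinearMap.id ℂ H)).comp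
          W.toLinearEquiv.toLinearMap) z h = tmul σ (W.toFun z) h := fun _ _ => rfl
      rw [hW, hW, inner_tmul_tmul, W.map_ip]

end Transform

section Main

variable {A B E F X Z₁ Z₂ H : Type*}
  [CStarAlgebra A] [PartialOrder A] [StarOrderedRing A]
  [CStarAlgebra B] [PartialOrder B] [StarOrderedRing B]
  [NormedAddCommGroup E] [NormedSpace ℂ E] [Module A E] [Module Aᵐᵒᵖ E]
  [RightHilbertModule A E] [WStarCorrespondence A A E]
  [NormedAddCommGroup F] [NormedSpace ℂ F] [Module B F] [Module Bᵐᵒᵖ F]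
  [RightHilbertModule B F] [WStarCorrespondence B B F]
  [NormedAddCommGroup X] [NormedSpace ℂ X] [Module A X] [Module Bᵐᵒᵖ X]
  [RightHilbertModule B X] [WStarCorrespondence A B X]
  [NormedAddCommGroup Z₁] [NormedSpace ℂ Z₁] [Module A Z₁] [Module Bᵐᵒᵖ Z₁]
  [RightHilbertModule B Z₁] [WStarCorrespondence A B Z₁]
  [NormedAddCommGroup Z₂] [NormedSpace ℂ Z₂] [Module A Z₂] [Module Bᵐᵒᵖ Z₂]
  [RightHilbertModule B Z₂] [WStarCorrespondence A B Z₂]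
  [NormedAddCommGroup H] [InnerProductSpace ℂ H] [CompleteSpace H]

/-- The operator `(I_X ⊗ η^*)(W ⊗ I_H) : E ⊗ (X ⊗_σ H) → X ⊗_σ H`, where `W` is an isomorphism
from the W⋆-tensor product `Z₁` of `E` and `X` onto the W⋆-tensor product `Z₂` of `X` and `F`.
It is the composite
`E ⊗ (X ⊗_σ H) → Z₁ ⊗_σ H → Z₂ ⊗_σ H → X ⊗ (F ⊗_σ H) → X ⊗_σ H`
of the canonical unitary, of `W ⊗ I_H`, of the inverse (that is, the adjoint) of the canonical
unitary, and of `I_X ⊗ η^*`. -/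
def transform {t₁ : E →ₗ[ℂ] X →ₗ[ℂ] Z₁} (ht₁ : IsWStarTensor A A B t₁)
    {t₂ : X →ₗ[ℂ] F →ₗ[ℂ] Z₂} (ht₂ : IsWStarTensor A B B t₂)
    (W : CorrespondenceIso A B Z₁ Z₂) (σ : B →⋆ₙₐ[ℂ] (H →L[ℂ] H)) (η : intertwiners F σ) :
    Ind E (indRep A X σ) →L[ℂ] Ind X σ :=
  indMap X η.1 η.2 ∘L ContinuousLinearMap.adjoint (assocIsom ht₂ σ) ∘L isoTensorId W σ ∘L
    assocIsom ht₁ σ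

end Main

end WStarMorita

end

/-!
The isomorphism `W` identifies `E ⊗ (X ⊗_σ H)` with `X ⊗ (F ⊗_σ H)` by a unitary that commutes with
the actions of `A`, so everything reduces to `η ↦ I_X ⊗ η`. This map is inverted by the same
construction for the conjugate bimodule `X̃`, since `x̃ ⊗ (y ⊗ h) ↦ σ(⟨x, y⟩) h` identifies
`X̃ ⊗ (X ⊗_σ H)` with the range of the projection `σ(1)`; both directions are contractive. Hence
`η ↦ (I_X ⊗ η)(W ⊗ I_H)` is an isometric isomorphism of the intertwiner spaces. It carries one open
unit disc onto the other, and conjugation by it identifies their biholomorphic automorphisms.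

Weak-⋆ density enters through normality only: for a normal vector functional a weak-⋆ dense subspace
of `B` is enough to approximate `σ(1) h` in norm, so operators can be compared on the vectors
`σ(⟨x, y⟩) h`.
-/

open scoped TensorProduct RightActions

noncomputable section

namespace WStarMorita

open CategoryTheory Filter Topology
open ContinuousLinearMap (adjoint)
open RightHilbertModule (ip)

/-! ### Weak limits of monotone nets -/

section WeakLimits

variable {ι : Type*} {l : Filter ι}

lemma exists_weak_limit {𝕜 H : Type*} [RCLike 𝕜] [NormedAddCommGroup H] [InnerProductSpace 𝕜 H]
    [CompleteSpace H] [l.NeBot] {p : ι → H →L[𝕜] H} {C : ℝ} (hC : ∀ᶠ i in l, ‖p i‖ ≤ C)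
    (hp : ∀ v w, ∃ z, Tendsto (fun i => inner 𝕜 (p i v) w) l (𝓝 z)) :
    ∃ P : H →L[𝕜] H, ∀ v w, Tendsto (fun i => inner 𝕜 (p i v) w) l (𝓝 (inner 𝕜 (P v) w)) := by
  choose L hL using hp
  have norm_L_le : ∀ v w, ‖L v w‖ ≤ C * ‖v‖ * ‖w‖ := fun v w => by
    refine le_of_tendsto (hL v w).norm ?_
    filter_upwards [hC] with i hi
    exact (norm_inner_le_norm _ _).trans (by gcongr; exact (p i).le_of_opNorm_le hi v)
  let Q : H →ₗ⋆[𝕜] H →ₗ[𝕜] 𝕜 := LinearMap.mk₂'ₛₗ (starRingEnd 𝕜) (RingHom.id 𝕜) L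
    (fun v v' w => tendsto_nhds_unique (hL _ _)
      (((hL v w).add (hL v' w)).congr fun i => by rw [map_add, inner_add_left]))
    (fun c v w => tendsto_nhds_unique (hL _ _)
      (((hL v w).const_mul (starRingEnd 𝕜 c)).congr fun i => by
        rw [map_smul, inner_smul_left]))
    (fun v w w' => tendsto_nhds_unique (hL _ _)
      (((hL v w).add (hL v w')).congr fun i => by rw [inner_add_right]))
    (fun c v w => tendsto_nhds_unique (hL _ _)
      (((hL v w).const_mul c).congr fun i => by rw [inner_smul_right]))
  refine ⟨InnerProductSpace.continuousLinearMapOfBilin (Q.mkContinuous₂ C norm_L_le),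
    fun v w => ?_⟩
  rw [InnerProductSpace.continuousLinearMapOfBilin_apply]
  exact hL v w

variable {H : Type*} [NormedAddCommGroup H] [InnerProductSpace ℂ H]

lemma exists_tendsto_inner_of_quadratic {p : ι → H →L[ℂ] H}
    (hp : ∀ v, ∃ z, Tendsto (fun i => inner ℂ (p i v) v) l (𝓝 z)) (v w : H) :
    ∃ z, Tendsto (fun i => inner ℂ (p i v) w) l (𝓝 z) := by
  obtain ⟨z₁, h₁⟩ := hp (v + w)
  obtain ⟨z₂, h₂⟩ := hp (v - w)
  obtain ⟨z₃, h₃⟩ := hp (v + Complex.I • w)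
  obtain ⟨z₄, h₄⟩ := hp (v - Complex.I • w)
  exact ⟨_, ((((h₁.sub h₂).sub (h₃.const_mul Complex.I)).add
    (h₄.const_mul Complex.I)).div_const 4).congr fun i =>
      (inner_map_polarization' (p i).toLinearMap v w).symm⟩

lemma isPositive_of_tendsto [l.NeBot] {p : ι → H →L[ℂ] H} {P : H →L[ℂ] H}
    (hp : ∀ᶠ i in l, (p i).IsPositive)
    (hP : ∀ v, Tendsto (fun i => inner ℂ (p i v) v) l (𝓝 (inner ℂ (P v) v))) : P.IsPositive := by
  refine (P.isPositive_iff_complex).mpr fun v => ?_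
  have hre : Tendsto (fun i => (inner ℂ (p i v) v).re) l (𝓝 (inner ℂ (P v) v).re) :=
    (Complex.continuous_re.tendsto _).comp (hP v)
  constructor
  · refine tendsto_nhds_unique ?_ (hP v)
    refine ((Complex.continuous_ofReal.tendsto _).comp hre).congr' ?_
    filter_upwards [hp] with i hi
    exact (((p i).isPositive_iff_complex.mp hi) v).1
  · refine ge_of_tendsto hre ?_
    filter_upwards [hp] with i hi
    exact (((p i).isPositive_iff_complex.mp hi) v).2

lemma exists_tendsto_inner_of_antitone [Preorder ι] [IsDirectedOrder ι] [Nonempty ι]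
    {p : ι → H →L[ℂ] H} (hp : Antitone p) (hpos : ∀ i, 0 ≤ p i) (v : H) :
    ∃ z, Tendsto (fun i => inner ℂ (p i v) v) atTop (𝓝 z) := by
  have hanti : Antitone fun i => (inner ℂ (p i v) v).re := fun i j hij => by
    have h := ((ContinuousLinearMap.le_def _ _).mp (hp hij)).inner_nonneg_left v
    simpa only [sub_apply, inner_sub_left, Complex.le_def, Complex.zero_re, Complex.sub_re,
      sub_nonneg] using (Complex.le_def.mp h).1
  have hbdd : BddBelow (Set.range fun i => (inner ℂ (p i v) v).re) :=
    ⟨0, Set.forall_mem_range.mpr fun i => (Complex.le_def.mp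
      (((ContinuousLinearMap.nonneg_iff_isPositive _).mp (hpos i)).inner_nonneg_left v)).1⟩
  refine ⟨_, ((Complex.continuous_ofReal.tendsto _).comp
    (tendsto_atTop_ciInf hanti hbdd)).congr fun i => ?_⟩
  exact ((ContinuousLinearMap.isPositive_iff_complex _).mp
    ((ContinuousLinearMap.nonneg_iff_isPositive _).mp (hpos i)) v).1

variable [CompleteSpace H]

lemma exists_weak_limit_of_antitone [Preorder ι] [IsDirectedOrder ι] [Nonempty ι]
    {p : ι → H →L[ℂ] H} (hp : Antitone p) (hpos : ∀ i, 0 ≤ p i) :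
    ∃ P : H →L[ℂ] H, ∀ v w, Tendsto (fun i => inner ℂ (p i v) w) atTop (𝓝 (inner ℂ (P v) w)) := by
  obtain ⟨i₀⟩ := ‹Nonempty ι›
  refine exists_weak_limit (C := ‖p i₀‖) ?_
    (exists_tendsto_inner_of_quadratic (exists_tendsto_inner_of_antitone hp hpos))
  filter_upwards [eventually_ge_atTop i₀] with i hi
  exact CStarAlgebra.norm_le_norm_of_nonneg_of_le (hpos i) (hp hi)

lemma exists_re_inner_sub_lt_of_isLUB {S : Set (H →L[ℂ] H)} (hne : S.Nonempty)
    (hdir : DirectedOn (· ≤ ·) S) {T : H →L[ℂ] H} (hT : IsLUB S T) (v : H) {ε : ℝ} (hε : 0 < ε) :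
    ∃ s ∈ S, (inner ℂ ((T - s) v) v).re < ε := by
  have : Nonempty S := hne.to_subtype
  have : IsDirectedOrder S := directedOn_iff_isDirectedOrder.mp hdir
  have hanti : Antitone fun s : S => T - s.1 := fun s t hst =>
    sub_le_sub_left (show s.1 ≤ t.1 from hst) T
  obtain ⟨P, hP⟩ := exists_weak_limit_of_antitone hanti fun s =>
    sub_nonneg.mpr (hT.1 s.2)
  have hub : T - P ∈ upperBounds S := fun s hs => by
    refine (ContinuousLinearMap.le_def _ _).mpr <|
      isPositive_of_tendsto (l := atTop) (p := fun t : S => (T - s) - (T - t.1)) ?_ fun v => ?_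
    · filter_upwards [eventually_ge_atTop (⟨s, hs⟩ : S)] with t ht
      exact (ContinuousLinearMap.nonneg_iff_isPositive _).mp (sub_nonneg.mpr (hanti ht))
    · rw [sub_right_comm]
      simp_rw [sub_apply (T - s), inner_sub_left (𝕜 := ℂ) ((T - s) v)]
      exact (hP v v).const_sub _
  have hle : (inner ℂ (P v) v).re ≤ 0 := by
    have h := ((ContinuousLinearMap.le_def _ _).mp (hT.2 hub)).inner_nonneg_left v
    rw [sub_sub_cancel_left, neg_apply, inner_neg_left] at h
    exact neg_nonneg.mp (Complex.le_def.mp h).1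
  obtain ⟨s, hs⟩ := (((Complex.continuous_re.tendsto _).comp (hP v v)).eventually_lt_const
    (hle.trans_lt hε)).exists
  exact ⟨s, s.2, hs⟩

end WeakLimits

/-! ### Normal vectors of a representation -/

section NormalVectors

open scoped ComplexOrder

lemma scottContinuous_iff_exists_re_lt {V : Type*} [AddCommGroup V] [PartialOrder V]
    [IsOrderedAddMonoid V] [Module ℂ V] {φ : V →ₚ[ℂ] ℂ} :
    ScottContinuous φ ↔ ∀ ⦃D : Set V⦄, D.Nonempty → DirectedOn (· ≤ ·) D → ∀ ⦃a : V⦄, IsLUB D a →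
      ∀ ε : ℝ, 0 < ε → ∃ d ∈ D, (φ (a - d)).re < ε := by
  have hmono : Monotone φ := OrderHomClass.mono φ
  constructor
  · intro hφ D hne hdir a ha ε hε
    by_contra! hD
    have hub : φ a - ε ∈ upperBounds (φ '' D) := by
      rintro _ ⟨d, hd, rfl⟩
      have him := (Complex.le_def.mp (hmono (ha.1 hd))).2
      have hre := hD d hd
      rw [map_sub, Complex.sub_re] at hre
      exact Complex.le_def.mpr ⟨by simp only [Complex.sub_re, Complex.ofReal_re]; linarith,
        by simpa using him⟩
    have h := (Complex.le_def.mp ((hφ hne hdir ha).2 hub)).1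
    simp only [Complex.sub_re, Complex.ofReal_re] at h
    linarith
  · intro hφ D hne hdir a ha
    refine ⟨Set.forall_mem_image.mpr fun d hd => hmono (ha.1 hd), fun c hc => ?_⟩
    have hc' : ∀ d ∈ D, φ d ≤ c := fun d hd => hc ⟨d, hd, rfl⟩
    refine Complex.le_def.mpr ⟨le_of_forall_pos_le_add fun ε hε => ?_, ?_⟩
    · obtain ⟨d, hd, hlt⟩ := hφ hne hdir ha ε hε
      rw [map_sub, Complex.sub_re] at hlt
      linarith [(Complex.le_def.mp (hc' d hd)).1]
    · obtain ⟨d, hd⟩ := hne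
      exact (Complex.le_def.mp (hmono (ha.1 hd))).2.symm.trans (Complex.le_def.mp (hc' d hd)).2

variable {B H : Type*} [CStarAlgebra B]
  [NormedAddCommGroup H] [InnerProductSpace ℂ H] [CompleteSpace H]
  {π : B →⋆ₙₐ[ℂ] (H →L[ℂ] H)}

lemma inner_rep_star_mul_self (π : B →⋆ₙₐ[ℂ] (H →L[ℂ] H)) (c : B) (ξ : H) :
    inner ℂ ξ (π (star c * c) ξ) = (‖π c ξ‖ ^ 2 : ℝ) := by
  rw [map_mul, map_star, mul_apply_eq_comp, ContinuousLinearMap.star_eq_adjoint,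
    ContinuousLinearMap.adjoint_inner_right, inner_self_eq_norm_sq_to_K]
  norm_cast

variable [PartialOrder B]

lemma continuous_normalFunctional (ω : NormalFunctional B) :
    @Continuous B ℂ (weakStarTopology B) _ fun b => ω.1 b :=
  continuous_iInf_dom (i := ω) continuous_induced_dom

lemma normalFunctional_eq_zero {G : Set B}
    (hG : @Dense B (weakStarTopology B) (Submodule.span ℂ G : Set B))
    (ω : NormalFunctional B) (h : ∀ g ∈ G, ω.1 g = 0) (b : B) : ω.1 b = 0 := by
  have hspan : Submodule.span ℂ G ≤ LinearMap.ker ω.1.toLinearMap := Submodule.span_le.mpr h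
  exact congrFun (@Continuous.ext_on ℂ B _ (weakStarTopology B) _ _ hG _ _
    (continuous_normalFunctional ω) (@continuous_const B ℂ (weakStarTopology B) _ 0) hspan) b

variable [StarOrderedRing B]

/-- The vector functional `b ↦ ⟨ξ, π(b) ξ⟩` of a representation `π`. -/
def vectorFunctional (π : B →⋆ₙₐ[ℂ] (H →L[ℂ] H)) (ξ : H) : B →ₚ[ℂ] ℂ :=
  PositiveLinearMap.mk₀
    { toFun := fun b => inner ℂ ξ (π b ξ)
      map_add' := fun b c => by rw [map_add, add_apply, inner_add_right]
      map_smul' := fun c b => by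
        rw [map_smul, smul_apply, inner_smul_right, RingHom.id_apply, smul_eq_mul] }
    fun b hb => by
      obtain ⟨c, rfl⟩ := CStarAlgebra.nonneg_iff_eq_star_mul_self.mp hb
      exact (Complex.zero_le_real.mpr (sq_nonneg _)).trans_eq (inner_rep_star_mul_self π c ξ).symm

lemma vectorFunctional_apply (π : B →⋆ₙₐ[ℂ] (H →L[ℂ] H)) (ξ : H) (b : B) :
    vectorFunctional π ξ b = inner ℂ ξ (π b ξ) := rfl

lemma re_vectorFunctional_sub_le (π : B →⋆ₙₐ[ℂ] (H →L[ℂ] H)) (ξ : H) (a : B) {d e : B}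
    (h : d ≤ e) : (vectorFunctional π ξ (a - e)).re ≤ (vectorFunctional π ξ (a - d)).re :=
  (Complex.le_def.mp (OrderHomClass.mono (vectorFunctional π ξ) (sub_le_sub_left h a))).1

lemma re_vectorFunctional_add_le (π : B →⋆ₙₐ[ℂ] (H →L[ℂ] H)) {b : B} (hb : 0 ≤ b) (ξ ζ : H) :
    (vectorFunctional π (ξ + ζ) b).re ≤
      2 * (vectorFunctional π ξ b).re + 2 * (vectorFunctional π ζ b).re := by
  have h := (Complex.le_def.mp (map_nonneg (vectorFunctional π (ξ - ζ)) hb)).1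
  simp only [vectorFunctional_apply, map_sub, map_add, inner_sub_left, inner_sub_right,
    inner_add_left, inner_add_right, Complex.sub_re, Complex.add_re, Complex.zero_re] at h ⊢
  linarith

lemma re_vectorFunctional_le (π : B →⋆ₙₐ[ℂ] (H →L[ℂ] H)) (ξ : H) (b : B) :
    (vectorFunctional π ξ b).re ≤ ‖b‖ * ‖ξ‖ ^ 2 := by
  calc (vectorFunctional π ξ b).re ≤ ‖inner ℂ ξ (π b ξ)‖ := Complex.re_le_norm _
    _ ≤ ‖ξ‖ * ‖π b ξ‖ := norm_inner_le_norm _ _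
    _ ≤ ‖ξ‖ * (‖b‖ * ‖ξ‖) := by
      gcongr; exact (π b).le_of_opNorm_le (NonUnitalStarAlgHom.norm_apply_le π b) ξ
    _ = ‖b‖ * ‖ξ‖ ^ 2 := by ring

/-- A vector is normal for a representation if its vector functional preserves the suprema of
increasing nets. -/
def IsNormalVector (π : B →⋆ₙₐ[ℂ] (H →L[ℂ] H)) (ξ : H) : Prop :=
  ScottContinuous (vectorFunctional π ξ)

lemma isNormalVector_id (v : H) : IsNormalVector (NonUnitalStarAlgHom.id ℂ (H →L[ℂ] H)) v :=
  scottContinuous_iff_exists_re_lt.mpr fun D hne hdir T hT ε hε => by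
    obtain ⟨S, hS, hlt⟩ := exists_re_inner_sub_lt_of_isLUB hne hdir hT v hε
    exact ⟨S, hS, (inner_re_symm (𝕜 := ℂ) _ _).trans_lt hlt⟩

lemma isNormalVector_of_scottContinuous (hπ : ScottContinuous π) (ξ : H) : IsNormalVector π ξ :=
  hπ.comp (isNormalVector_id ξ)

lemma isNormalVector_zero : IsNormalVector π 0 :=
  scottContinuous_iff_exists_re_lt.mpr fun _ ⟨d, hd⟩ _ _ _ _ hε =>
    ⟨d, hd, by rwa [vectorFunctional_apply, inner_zero_left, Complex.zero_re]⟩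

lemma IsNormalVector.add {ξ ζ : H} (hξ : IsNormalVector π ξ) (hζ : IsNormalVector π ζ) :
    IsNormalVector π (ξ + ζ) :=
  scottContinuous_iff_exists_re_lt.mpr fun D hne hdir a ha ε hε => by
    obtain ⟨d₁, hd₁, h₁⟩ :=
      scottContinuous_iff_exists_re_lt.mp hξ hne hdir ha (ε / 4) (by positivity)
    obtain ⟨d₂, hd₂, h₂⟩ :=
      scottContinuous_iff_exists_re_lt.mp hζ hne hdir ha (ε / 4) (by positivity)
    obtain ⟨d, hd, hd₁d, hd₂d⟩ := hdir d₁ hd₁ d₂ hd₂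
    refine ⟨d, hd, ?_⟩
    linarith [re_vectorFunctional_add_le π (sub_nonneg.mpr (ha.1 hd)) ξ ζ,
      re_vectorFunctional_sub_le π ξ a hd₁d, re_vectorFunctional_sub_le π ζ a hd₂d]

lemma isClosed_isNormalVector (π : B →⋆ₙₐ[ℂ] (H →L[ℂ] H)) :
    IsClosed {ξ | IsNormalVector π ξ} := by
  refine isSeqClosed_iff_isClosed.mp fun u ξ hu hlim =>
    scottContinuous_iff_exists_re_lt.mpr fun D hne hdir a ha ε hε => ?_
  obtain ⟨d₀, hd₀⟩ := hne
  have herr : Tendsto (fun n => 2 * (‖a - d₀‖ * ‖ξ - u n‖ ^ 2)) atTop (𝓝 0) := by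
    simpa using ((((tendsto_const_nhds (x := ξ)).sub hlim).norm.pow 2).const_mul
      ‖a - d₀‖).const_mul 2
  obtain ⟨n, hn⟩ := (herr.eventually_lt_const (half_pos hε)).exists
  obtain ⟨d₁, hd₁, h₁⟩ :=
    scottContinuous_iff_exists_re_lt.mp (hu n) ⟨d₀, hd₀⟩ hdir ha (ε / 4) (by positivity)
  obtain ⟨d, hd, hd₀d, hd₁d⟩ := hdir d₀ hd₀ d₁ hd₁
  refine ⟨d, hd, ?_⟩
  have hsplit := re_vectorFunctional_add_le π (sub_nonneg.mpr (ha.1 hd)) (u n) (ξ - u n)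
  rw [add_sub_cancel] at hsplit
  linarith [re_vectorFunctional_sub_le π (u n) a hd₁d,
    (re_vectorFunctional_sub_le π (ξ - u n) a hd₀d).trans (re_vectorFunctional_le π _ _)]

lemma rep_one_mem_closure {G : Set B}
    (hG : @Dense B (weakStarTopology B) (Submodule.span ℂ G : Set B))
    (hπ : ∀ ξ, IsNormalVector π ξ) (k : H) :
    π 1 k ∈ (Submodule.span ℂ {v | ∃ g ∈ G, ∃ ξ, π g ξ = v}).topologicalClosure := by
  rw [← Submodule.orthogonal_orthogonal_eq_closure, Submodule.mem_orthogonal]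
  intro ζ hζ
  rw [Submodule.mem_orthogonal'] at hζ
  have hvanish : vectorFunctional π ζ 1 = 0 :=
    normalFunctional_eq_zero hG ⟨_, hπ ζ⟩
      (fun g hg => hζ _ (Submodule.subset_span ⟨g, hg, ζ, rfl⟩)) 1
  have hrep : π 1 ζ = 0 := by
    have hsq := inner_rep_star_mul_self π 1 ζ
    rw [star_one, one_mul, ← vectorFunctional_apply, hvanish] at hsq
    simpa using hsq.symm
  rw [← ContinuousLinearMap.adjoint_inner_left, ← ContinuousLinearMap.star_eq_adjoint, ← map_star,
    star_one, hrep, inner_zero_left]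

lemma comp_rep_one_eq {K : Type*} [NormedAddCommGroup K] [NormedSpace ℂ K] {G : Set B}
    (hG : @Dense B (weakStarTopology B) (Submodule.span ℂ G : Set B))
    (hπ : ∀ ξ, IsNormalVector π ξ) {S T : H →L[ℂ] K} (h : ∀ g ∈ G, ∀ ξ, S (π g ξ) = T (π g ξ)) :
    S ∘L π 1 = T ∘L π 1 := by
  have hle : (Submodule.span ℂ {v | ∃ g ∈ G, ∃ ξ, π g ξ = v}).topologicalClosure ≤
      LinearMap.eqLocus S.toLinearMap T.toLinearMap := by
    refine Submodule.topologicalClosure_minimal _ (Submodule.span_le.mpr ?_)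
      (isClosed_eq S.continuous T.continuous)
    rintro _ ⟨g, hg, ξ, rfl⟩
    exact h g hg ξ
  exact ContinuousLinearMap.ext fun k => hle (rep_one_mem_closure hG hπ k)

variable {A E : Type*} [CStarAlgebra A] [PartialOrder A] [StarOrderedRing A]
  [NormedAddCommGroup E] [NormedSpace ℂ E] [Module A E] [Module Bᵐᵒᵖ E]
  [RightHilbertModule B E] [WStarCorrespondence A B E]

lemma isNormalVector_indRep_tmul {h : H} (hh : IsNormalVector π h) (x : E) :
    IsNormalVector (indRep A E π) (tmul π x h) := by
  have heq : (vectorFunctional (indRep A E π) (tmul π x h) : A → ℂ) =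
      vectorFunctional π h ∘ fun a => ip x (a • x) := by
    ext a
    rw [vectorFunctional_apply, indRep_tmul, inner_tmul_tmul, Function.comp_apply,
      vectorFunctional_apply]
  rw [IsNormalVector, heq]
  exact (WStarCorrespondence.normal x).comp hh

lemma isNormalVector_indRep (hπ : ∀ h, IsNormalVector π h) (ξ : Ind E π) :
    IsNormalVector (indRep A E π) ξ := by
  induction ξ using ind_induction with
  | hp => exact isClosed_isNormalVector _
  | ih u =>
    induction u using pre_induction with
    | h0 => exact (map_zero (toInd E π)).symm ▸ isNormalVector_zero
    | ha u v hu hv => exact (map_add (toInd E π) u v).symm ▸ hu.add hv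
    | ht x h => exact isNormalVector_indRep_tmul (hπ h) x

end NormalVectors

/-! ### Hilbert-module estimates and the conjugate bimodule -/

section Basic

variable {B E : Type*} [CStarAlgebra B] [PartialOrder B]
  [NormedAddCommGroup E] [NormedSpace ℂ E] [Module Bᵐᵒᵖ E] [RightHilbertModule B E]

lemma ip_sub_right (x y z : E) : (ip x (y - z) : B) = ip x y - ip x z :=
  map_sub (ipₛₗ B E x) y z

variable (B E) in
/-- A right Hilbert `B`-module as a Mathlib Hilbert C⋆-module over `Bᵐᵒᵖ`; through it the
Cauchy–Schwarz inequality of Mathlib becomes available. -/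
abbrev opCStarModule : CStarModule Bᵐᵒᵖ E where
  inner x y := MulOpposite.op (ip x y)
  inner_add_right := congrArg MulOpposite.op (ip_add_right _ _ _)
  inner_self_nonneg := RightHilbertModule.ip_self_nonneg _
  inner_self {x} := by
    rw [MulOpposite.op_eq_zero_iff, ← norm_eq_zero, ← RightHilbertModule.norm_sq_eq,
      sq_eq_zero_iff, norm_eq_zero]
  inner_op_smul_right {b x y} := congrArg MulOpposite.op (ip_op_smul_right x y b.unop)
  inner_smul_right_complex := congrArg MulOpposite.op (ip_smul_right _ _ _)
  star_inner x y := congrArg MulOpposite.op (star_ip x y)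
  norm_eq_sqrt_norm_inner_self x := by
    rw [MulOpposite.norm_op, ← RightHilbertModule.norm_sq_eq, Real.sqrt_sq (norm_nonneg x)]

lemma norm_ip_le [StarOrderedRing B] (x y : E) : ‖(ip x y : B)‖ ≤ ‖x‖ * ‖y‖ :=
  letI := opCStarModule B E
  CStarModule.norm_inner_le (A := Bᵐᵒᵖ) E

end Basic

section Action

variable {A B E : Type*} [CStarAlgebra A] [PartialOrder A]
  [CStarAlgebra B] [PartialOrder B]
  [NormedAddCommGroup E] [NormedSpace ℂ E] [Module A E] [Module Bᵐᵒᵖ E]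
  [RightHilbertModule B E] [WStarCorrespondence A B E]

lemma ip_act_right (a : A) (x y : E) : (ip x (a • y) : B) = ip (star a • x) y := by
  rw [WStarCorrespondence.ip_act_left, star_star]

variable (B) in
lemma norm_act_le [StarOrderedRing A] [StarOrderedRing B] (a : A) (x : E) :
    ‖a • x‖ ≤ ‖a‖ * ‖x‖ := by
  refine le_mul_of_sq (norm_nonneg _) (norm_nonneg _) ?_
  have hle : (ip (a • x) (a • x) : B) ≤ ((‖a‖ ^ 2 : ℝ) : ℂ) • ip x x := by
    have hmono := (WStarCorrespondence.normal (A := A) (B := B) x).monotone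
      (CStarAlgebra.star_mul_le_algebraMap_norm_sq (a := a))
    simpa only [WStarCorrespondence.ip_act_left, mul_smul, Algebra.algebraMap_eq_smul_one,
      ← Complex.coe_smul, WStarCorrespondence.smul_smul_complex (B := B), one_smul,
      ip_smul_right] using hmono
  have hnorm := CStarAlgebra.norm_le_norm_of_nonneg_of_le
    (RightHilbertModule.ip_self_nonneg (a • x)) hle
  rwa [norm_smul, ← RightHilbertModule.norm_sq_eq, ← RightHilbertModule.norm_sq_eq,
    Complex.norm_real, Real.norm_of_nonneg (by positivity)] at hnorm

end Action

namespace EquivalenceBimodule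

variable {A B X : Type*} [CStarAlgebra A] [PartialOrder A] [CStarAlgebra B] [PartialOrder B]
  [NormedAddCommGroup X] [NormedSpace ℂ X] [Module A X] [Module Bᵐᵒᵖ X]
  [RightHilbertModule B X] [WStarCorrespondence A B X] (hX : EquivalenceBimodule A B X)

lemma lip_add_right (x y z : X) : hX.lip x (y + z) = hX.lip x y + hX.lip x z := by
  rw [← hX.star_lip, hX.lip_add_left, star_add, hX.star_lip, hX.star_lip]

lemma lip_smul_right (c : ℂ) (x y : X) : hX.lip x (star c • y) = c • hX.lip x y := by
  rw [← hX.star_lip, hX.lip_smul_left, star_smul, star_star, hX.star_lip]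

lemma lip_act_right (a : A) (x y : X) : hX.lip x (star a • y) = hX.lip x y * a := by
  rw [← hX.star_lip, hX.lip_act_left, star_mul, star_star, hX.star_lip]

/-- The conjugate right Hilbert `A`-module `X̃` of the left Hilbert `A`-module `X`: with `x̃`
denoting `x ∈ X` as an element of `X̃`, the operations are `c x̃ = (c̄ x)~`, `x̃ a = (a⋆ x)~` and
`⟨x̃, ỹ⟩ = ₐ⟨x, y⟩`. -/
def Conj (_hX : EquivalenceBimodule A B X) : Type _ := X

instance : NormedAddCommGroup hX.Conj := inferInstanceAs (NormedAddCommGroup X)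

instance : Module ℂ hX.Conj := Module.compHom X (starRingEnd ℂ)

instance : NormedSpace ℂ hX.Conj where
  norm_smul_le c x := (norm_smul_le (β := X) (star c) x).trans_eq (congrArg (· * _) (norm_star c))

instance : Module Aᵐᵒᵖ hX.Conj := Module.compHom X (starRingEquiv (R := A)).symm.toRingHom

/-- The conjugate linear identity `x ↦ x̃` from `X` to `X̃`. -/
def toConj : X ≃ₗ⋆[ℂ] hX.Conj where
  __ := AddEquiv.refl X
  map_smul' c x := congrArg (· • x) (star_star c).symm

instance : RightHilbertModule A hX.Conj where
  ip x y := hX.lip x y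
  ip_add_right := hX.lip_add_right
  ip_smul_right := hX.lip_smul_right
  ip_op_smul_right x y a := hX.lip_act_right a x y
  star_ip := hX.star_lip
  ip_self_nonneg := hX.lip_self_nonneg
  norm_sq_eq := hX.norm_sq_eq_lip

lemma norm_lip_le [StarOrderedRing A] (x y : X) : ‖hX.lip x y‖ ≤ ‖x‖ * ‖y‖ :=
  norm_ip_le (hX.toConj x) (hX.toConj y)

end EquivalenceBimodule

/-! ### Operators on induced Hilbert spaces -/

section ElementaryTensors

variable {B E H : Type*} [CStarAlgebra B] [PartialOrder B] [StarOrderedRing B]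
  [NormedAddCommGroup E] [NormedSpace ℂ E] [Module Bᵐᵒᵖ E] [RightHilbertModule B E]
  [NormedAddCommGroup H] [InnerProductSpace ℂ H] [CompleteSpace H]
  (σ : B →⋆ₙₐ[ℂ] (H →L[ℂ] H))

lemma tmul_sub_left (x y : E) (h : H) : tmul σ (x - y) h = tmul σ x h - tmul σ y h := by
  simp [tmul]

lemma tmul_add_right (x : E) (h k : H) : tmul σ x (h + k) = tmul σ x h + tmul σ x k := by
  simp [tmul]

lemma tmul_smul_right (c : ℂ) (x : E) (h : H) : tmul σ x (c • h) = c • tmul σ x h := by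
  simp [tmul]

lemma norm_tmul_sq (x : E) (h : H) : ‖tmul σ x h‖ ^ 2 = (inner ℂ h (σ (ip x x) h)).re := by
  rw [← inner_tmul_tmul]
  exact norm_sq_eq_re_inner (𝕜 := ℂ) _

lemma norm_tmul_le (x : E) (h : H) : ‖tmul σ x h‖ ≤ ‖x‖ * ‖h‖ := by
  refine le_mul_of_sq (norm_nonneg _) (norm_nonneg _) ?_
  rw [norm_tmul_sq, RightHilbertModule.norm_sq_eq (B := B)]
  exact re_vectorFunctional_le σ h (ip x x)

variable {σ} in
lemma ext_inner_tmul {ξ ζ : Ind E σ}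
    (h : ∀ x k, inner ℂ ξ (tmul σ x k) = inner ℂ ζ (tmul σ x k)) : ξ = ζ := by
  have heq : innerSL ℂ ξ = innerSL ℂ ζ := ind_ext σ h
  exact ext_inner_right ℂ fun v => DFunLike.congr_fun heq v

lemma tmul_op_smul (x : E) (b : B) (h : H) : tmul σ (x <• b) h = tmul σ x (σ b h) := by
  refine ext_inner_tmul fun y k => ?_
  rw [inner_tmul_tmul, inner_tmul_tmul, ip_op_smul_left, map_mul, map_star, mul_apply_eq_comp,
    ContinuousLinearMap.star_eq_adjoint, ContinuousLinearMap.adjoint_inner_right]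

lemma tmul_rep_one (x : E) (h : H) : tmul σ x (σ 1 h) = tmul σ x h := by
  rw [← tmul_op_smul, MulOpposite.op_one, one_smul]

/-- The creation operator `H → E ⊗_σ H`, `h ↦ x ⊗ h`, of `x ∈ E`. -/
def creation (x : E) : H →L[ℂ] Ind E σ :=
  LinearMap.mkContinuous
    { toFun := tmul σ x
      map_add' := tmul_add_right σ x
      map_smul' := fun c h => tmul_smul_right σ c x h } ‖x‖ (norm_tmul_le σ x)

lemma creation_apply (x : E) (h : H) : creation σ x h = tmul σ x h := rfl

lemma creation_op_smul (x : E) (b : B) : creation σ (x <• b) = creation σ x ∘L σ b :=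
  ContinuousLinearMap.ext (tmul_op_smul σ x b)

lemma adjoint_creation_tmul (x y : E) (h : H) :
    adjoint (creation σ x) (tmul σ y h) = σ (ip x y) h := by
  refine ext_inner_left ℂ fun k => ?_
  rw [ContinuousLinearMap.adjoint_inner_right, creation_apply, inner_tmul_tmul]

lemma adjoint_creation_op_smul_star (x : E) (b : B) :
    adjoint (creation σ (x <• star b)) = σ b ∘L adjoint (creation σ x) := by
  rw [creation_op_smul, ContinuousLinearMap.adjoint_comp, map_star,
    ContinuousLinearMap.star_eq_adjoint, ContinuousLinearMap.adjoint_adjoint]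

variable {M : Type*}

lemma norm_indLift_le [NormedAddCommGroup M] [NormedSpace ℂ M] [CompleteSpace M]
    (f : E →ₗ[ℂ] H →ₗ[ℂ] M) {C : ℝ} (hC₀ : 0 ≤ C) (hC : ∀ u, ‖preLift σ f u‖ ≤ C * ‖u‖) :
    ‖indLift σ f C hC‖ ≤ C := by
  refine ContinuousLinearMap.opNorm_le_bound _ hC₀ fun ξ => ?_
  induction ξ using ind_induction with
  | hp => exact isClosed_le (by fun_prop) (by fun_prop)
  | ih u => rw [indLift_toInd, LinearIsometry.norm_map]; exact hC u

variable [NormedAddCommGroup M] [InnerProductSpace ℂ M] [CompleteSpace M]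

lemma adjoint_indIsom_comp (f : E →ₗ[ℂ] H →ₗ[ℂ] M)
    (hf : ∀ x h y k, inner ℂ (f x h) (f y k) = inner ℂ h (σ (ip x y) k)) :
    adjoint (indIsom σ f hf) ∘L indIsom σ f hf = ContinuousLinearMap.id ℂ (Ind E σ) := by
  refine ind_ext σ fun y k => ext_inner_tmul fun x h => ?_
  rw [ContinuousLinearMap.comp_apply, ContinuousLinearMap.adjoint_inner_left, indIsom_tmul,
    indIsom_tmul, hf, ContinuousLinearMap.id_apply, inner_tmul_tmul]

end ElementaryTensors

section IndMap

variable {B X H K : Type*} [CStarAlgebra B] [PartialOrder B] [StarOrderedRing B]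
  [NormedAddCommGroup X] [NormedSpace ℂ X] [Module Bᵐᵒᵖ X] [RightHilbertModule B X]
  [NormedAddCommGroup H] [InnerProductSpace ℂ H] [CompleteSpace H]
  [NormedAddCommGroup K] [InnerProductSpace ℂ K] [CompleteSpace K]
  {σ : B →⋆ₙₐ[ℂ] (H →L[ℂ] H)} {ρ : B →⋆ₙₐ[ℂ] (K →L[ℂ] K)}

lemma norm_indMap_le (η : K →L[ℂ] H) (hη : ∀ b, η ∘L ρ b = σ b ∘L η) : ‖indMap X η hη‖ ≤ ‖η‖ :=
  norm_indLift_le ρ _ (norm_nonneg η) _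

lemma indMap_add {η ζ : K →L[ℂ] H} (hη : ∀ b, η ∘L ρ b = σ b ∘L η)
    (hζ : ∀ b, ζ ∘L ρ b = σ b ∘L ζ) (hηζ : ∀ b, (η + ζ) ∘L ρ b = σ b ∘L (η + ζ)) :
    indMap X (η + ζ) hηζ = indMap X η hη + indMap X ζ hζ :=
  ind_ext ρ fun x k => by
    simp only [add_apply, indMap_tmul, tmul_add_right]

lemma indMap_smul (c : ℂ) {η : K →L[ℂ] H} (hη : ∀ b, η ∘L ρ b = σ b ∘L η)
    (hcη : ∀ b, (c • η) ∘L ρ b = σ b ∘L (c • η)) :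
    indMap X (c • η) hcη = c • indMap X η hη :=
  ind_ext ρ fun x k => by
    simp only [smul_apply, indMap_tmul, tmul_smul_right]

variable {A : Type*} [CStarAlgebra A] [PartialOrder A] [StarOrderedRing A] [Module A X]
  [WStarCorrespondence A B X]

lemma indMap_comp_indRep (η : K →L[ℂ] H) (hη : ∀ b, η ∘L ρ b = σ b ∘L η) (a : A) :
    indMap X η hη ∘L indRep A X ρ a = indRep A X σ a ∘L indMap X η hη :=
  ind_ext ρ fun x k => by
    simp only [ContinuousLinearMap.comp_apply, indRep_tmul, indMap_tmul]

lemma indRep_one (σ : B →⋆ₙₐ[ℂ] (H →L[ℂ] H)) :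
    indRep A X σ 1 = ContinuousLinearMap.id ℂ (Ind X σ) :=
  ind_ext σ fun x h => by rw [indRep_tmul, one_smul, ContinuousLinearMap.id_apply]

end IndMap

/-! ### Unitary intertwiners -/

section Unitary

variable {A K L : Type*} [CStarAlgebra A]
  [NormedAddCommGroup K] [InnerProductSpace ℂ K] [CompleteSpace K]
  [NormedAddCommGroup L] [InnerProductSpace ℂ L] [CompleteSpace L]

/-- The operator `V` is a unitary equivalence of the representation `π` with `π'`. -/
structure IsUnitaryIntertwiner (π : A →⋆ₙₐ[ℂ] (K →L[ℂ] K)) (π' : A →⋆ₙₐ[ℂ] (L →L[ℂ] L))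
    (V : K →L[ℂ] L) : Prop where
  adjoint_comp : adjoint V ∘L V = ContinuousLinearMap.id ℂ K
  comp_adjoint : V ∘L adjoint V = ContinuousLinearMap.id ℂ L
  comp_rep : ∀ a, V ∘L π a = π' a ∘L V

namespace IsUnitaryIntertwiner

variable {π : A →⋆ₙₐ[ℂ] (K →L[ℂ] K)} {π' : A →⋆ₙₐ[ℂ] (L →L[ℂ] L)} {V : K →L[ℂ] L}

lemma symm (hV : IsUnitaryIntertwiner π π' V) : IsUnitaryIntertwiner π' π (adjoint V) where
  adjoint_comp := by rw [ContinuousLinearMap.adjoint_adjoint, hV.comp_adjoint]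
  comp_adjoint := by rw [ContinuousLinearMap.adjoint_adjoint, hV.adjoint_comp]
  comp_rep a := by
    have h := congrArg adjoint (hV.comp_rep (star a))
    simp only [ContinuousLinearMap.adjoint_comp, map_star, ContinuousLinearMap.star_eq_adjoint,
      ContinuousLinearMap.adjoint_adjoint] at h
    exact h.symm

variable {M : Type*} [NormedAddCommGroup M] [InnerProductSpace ℂ M]

lemma comp [CompleteSpace M] {π'' : A →⋆ₙₐ[ℂ] (M →L[ℂ] M)} {U : L →L[ℂ] M}
    (hU : IsUnitaryIntertwiner π' π'' U) (hV : IsUnitaryIntertwiner π π' V) :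
    IsUnitaryIntertwiner π π'' (U ∘L V) where
  adjoint_comp := by
    rw [ContinuousLinearMap.adjoint_comp, ContinuousLinearMap.comp_assoc,
      ← ContinuousLinearMap.comp_assoc _ U V, hU.adjoint_comp, ContinuousLinearMap.id_comp,
      hV.adjoint_comp]
  comp_adjoint := by
    rw [ContinuousLinearMap.adjoint_comp, ContinuousLinearMap.comp_assoc,
      ← ContinuousLinearMap.comp_assoc V, hV.comp_adjoint, ContinuousLinearMap.id_comp,
      hU.comp_adjoint]
  comp_rep a := by
    rw [ContinuousLinearMap.comp_assoc, hV.comp_rep, ← ContinuousLinearMap.comp_assoc,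
      hU.comp_rep, ContinuousLinearMap.comp_assoc]

lemma norm_le_one (hV : IsUnitaryIntertwiner π π' V) : ‖V‖ ≤ 1 :=
  ContinuousLinearMap.opNorm_le_bound _ zero_le_one fun x => by
    rw [(ContinuousLinearMap.norm_map_iff_adjoint_comp_self V).mpr hV.adjoint_comp, one_mul]

lemma norm_comp_eq (hV : IsUnitaryIntertwiner π π' V) (T : L →L[ℂ] M) : ‖T ∘L V‖ = ‖T‖ := by
  refine le_antisymm ((T.opNorm_comp_le V).trans
    (mul_le_of_le_one_right (norm_nonneg _) hV.norm_le_one)) ?_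
  calc ‖T‖ = ‖(T ∘L V) ∘L adjoint V‖ := by
        rw [ContinuousLinearMap.comp_assoc, hV.comp_adjoint, ContinuousLinearMap.comp_id]
    _ ≤ ‖T ∘L V‖ * ‖adjoint V‖ := ContinuousLinearMap.opNorm_comp_le _ _
    _ ≤ ‖T ∘L V‖ := mul_le_of_le_one_right (norm_nonneg _) hV.symm.norm_le_one

end IsUnitaryIntertwiner

end Unitary

/-! ### The canonical isometries are unitaries -/

section Tensor

variable {C A B E X Z H : Type*}
  [CStarAlgebra C] [PartialOrder C]
  [CStarAlgebra A] [PartialOrder A]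
  [CStarAlgebra B] [PartialOrder B] [StarOrderedRing B]
  [NormedAddCommGroup E] [NormedSpace ℂ E] [Module C E] [Module Aᵐᵒᵖ E]
  [RightHilbertModule A E] [WStarCorrespondence C A E]
  [NormedAddCommGroup X] [NormedSpace ℂ X] [Module A X] [Module Bᵐᵒᵖ X]
  [RightHilbertModule B X] [WStarCorrespondence A B X]
  [NormedAddCommGroup Z] [NormedSpace ℂ Z] [Module C Z] [Module Bᵐᵒᵖ Z]
  [RightHilbertModule B Z] [WStarCorrespondence C B Z]
  [NormedAddCommGroup H] [InnerProductSpace ℂ H] [CompleteSpace H]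
  {t : E →ₗ[ℂ] X →ₗ[ℂ] Z} {σ : B →⋆ₙₐ[ℂ] (H →L[ℂ] H)}

namespace IsWStarTensor

open scoped ComplexOrder in
lemma tmul_congr (ht : IsWStarTensor C A B t) (hσ : ∀ h, IsNormalVector σ h) {z z' : Z}
    (hz : ∀ e x, (ip (t e x) z : B) = ip (t e x) z') (h : H) : tmul σ z h = tmul σ z' h := by
  let ω : NormalFunctional B := ⟨vectorFunctional σ h, hσ h⟩
  have hcont : @Continuous Z ℂ (moduleWeakStarTopology B Z) _ fun y => ω.1 (ip (z - z') y) :=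
    continuous_iInf_dom (i := ω) (continuous_iInf_dom (i := z - z') continuous_induced_dom)
  have hspan : Submodule.span ℂ {y | ∃ e x, t e x = y} ≤
      LinearMap.ker (ω.1.toLinearMap.comp (ipₛₗ B Z (z - z'))) := by
    refine Submodule.span_le.mpr ?_
    rintro _ ⟨e, x, rfl⟩
    change ω.1 (ip (z - z') (t e x)) = 0
    rw [← star_ip, ip_sub_right, hz, sub_self, star_zero, map_zero]
  have hzero : ω.1 (ip (z - z') (z - z')) = 0 :=
    congrFun (@Continuous.ext_on ℂ Z _ (moduleWeakStarTopology B Z) _ _ ht.dense _ _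
      hcont (@continuous_const Z ℂ (moduleWeakStarTopology B Z) _ 0) hspan) (z - z')
  rw [← sub_eq_zero, ← tmul_sub_left, ← norm_eq_zero, ← sq_eq_zero_iff, norm_tmul_sq]
  exact congrArg Complex.re hzero

variable [StarOrderedRing A]

lemma norm_tmul_le (ht : IsWStarTensor C A B t) (e : E) (x : X) : ‖t e x‖ ≤ ‖e‖ * ‖x‖ := by
  refine le_mul_of_sq (norm_nonneg _) (norm_nonneg _) ?_
  rw [RightHilbertModule.norm_sq_eq (B := B), ht.ip_tmul]
  calc ‖(ip x ((ip e e : A) • x) : B)‖ ≤ ‖x‖ * ‖(ip e e : A) • x‖ := norm_ip_le _ _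
    _ ≤ ‖x‖ * (‖(ip e e : A)‖ * ‖x‖) := by gcongr; exact norm_act_le B _ _
    _ = ‖e‖ ^ 2 * ‖x‖ ^ 2 := by rw [← RightHilbertModule.norm_sq_eq]; ring

lemma exists_contract (ht : IsWStarTensor C A B t) (e : E) (z : Z) :
    ∃ w : X, ∀ x, (ip x w : B) = ip (t e x) z := by
  let f : X →L[ℂ] B := ((ipₛₗ B Z z).comp (t e)).mkContinuous (‖z‖ * ‖e‖) fun x => by
    refine (norm_ip_le z (t e x)).trans ?_
    rw [mul_assoc]
    gcongr
    exact ht.norm_tmul_le e x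
  have hf : ∀ x (b : B), f (x <• b) = f x * b := fun x b =>
    (congrArg (ip z) (ht.act_right e x b)).trans (ip_op_smul_right z (t e x) b)
  obtain ⟨w, hw⟩ := WStarCorrespondence.selfDual (A := A) (B := B) f hf
  exact ⟨w, fun x => by rw [← star_ip w x, ← star_ip z (t e x), ← hw]; rfl⟩

variable (ht : IsWStarTensor C A B t)

/-- The contraction of `z ∈ E ⊗ X` by `e ∈ E`, that is, the value at `z` of the adjoint of
`x ↦ e ⊗ x`. -/
def contract (e : E) (z : Z) : X := (ht.exists_contract e z).choose

lemma ip_contract (e : E) (z : Z) (x : X) : (ip x (ht.contract e z) : B) = ip (t e x) z :=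
  (ht.exists_contract e z).choose_spec x

lemma contract_add (e e' : E) (z : Z) :
    ht.contract (e + e') z = ht.contract e z + ht.contract e' z :=
  ext_ip B fun x => by
    simp only [ip_add_right, ht.ip_contract, map_add, LinearMap.add_apply, ip_add_left]

lemma contract_smul (c : ℂ) (e : E) (z : Z) :
    ht.contract (c • e) z = star c • ht.contract e z :=
  ext_ip B fun x => by
    simp only [ip_smul_right, ht.ip_contract, map_smul, LinearMap.smul_apply, ip_smul_left]

lemma contract_op_smul (e : E) (a : A) (z : Z) :
    ht.contract (e <• a) z = star a • ht.contract e z :=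
  ext_ip B fun x => by
    rw [ip_act_right, ht.ip_contract, ht.ip_contract, ht.balanced, star_star]

lemma norm_contract_le (e : E) (z : Z) : ‖ht.contract e z‖ ≤ ‖e‖ * ‖z‖ := by
  have h : ‖ht.contract e z‖ ^ 2 ≤ ‖e‖ * ‖ht.contract e z‖ * ‖z‖ := by
    rw [RightHilbertModule.norm_sq_eq (B := B), ht.ip_contract]
    refine (norm_ip_le _ _).trans ?_
    gcongr
    exact ht.norm_tmul_le _ _
  rcases (norm_nonneg (ht.contract e z)).eq_or_lt with h0 | hpos
  · rw [← h0]; positivity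
  · nlinarith

include ht

lemma exists_tmul_op_smul_eq (hX : EquivalenceBimodule A B X) (hσ : ∀ h, IsNormalVector σ h)
    (z : Z) (x y : X) : ∃ u : E, ∀ h, tmul σ (z <• (ip x y : B)) h = tmul σ (t u y) h := by
  let f : E →L[ℂ] A := LinearMap.mkContinuous
    { toFun := fun e => hX.lip x (ht.contract e z)
      map_add' := fun e e' => by rw [ht.contract_add, hX.lip_add_right]
      map_smul' := fun c e => by rw [ht.contract_smul, hX.lip_smul_right, RingHom.id_apply] }
    (‖x‖ * ‖z‖) fun e => (hX.norm_lip_le x (ht.contract e z)).trans <| by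
      rw [mul_assoc, mul_comm ‖z‖]
      gcongr
      exact ht.norm_contract_le e z
  have hf : ∀ e (a : A), f (e <• a) = f e * a := fun e a =>
    (congrArg (hX.lip x) (ht.contract_op_smul e a z)).trans (hX.lip_act_right a x _)
  obtain ⟨u, hu⟩ := WStarCorrespondence.selfDual (A := C) (B := A) f hf
  have hip : ∀ e, (ip e u : A) = hX.lip (ht.contract e z) x := fun e => by
    rw [← star_ip, ← hu]
    exact hX.star_lip _ _
  refine ⟨u, ht.tmul_congr hσ fun e w => ?_⟩
  rw [ip_op_smul_right, ht.ip_tmul, hip, hX.lip_smul, ip_op_smul_right, ht.ip_contract]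

variable {L : Type*} [NormedAddCommGroup L] [NormedSpace ℂ L] {S T : Ind Z σ →L[ℂ] L}

lemma ext_of_right (hX : EquivalenceBimodule A B X) (hσ : ∀ h, IsNormalVector σ h)
    (h : ∀ e x k, S (tmul σ (t e x) k) = T (tmul σ (t e x) k)) : S = T := by
  refine ind_ext σ fun z k => ?_
  have hone := comp_rep_one_eq hX.right_full hσ (S := S ∘L creation σ z) (T := T ∘L creation σ z)
    (by
      rintro _ ⟨x, y, rfl⟩ v
      obtain ⟨u, hu⟩ := ht.exists_tmul_op_smul_eq hX hσ z x y
      simp only [ContinuousLinearMap.comp_apply, creation_apply, ← tmul_op_smul, hu, h])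
  simpa only [ContinuousLinearMap.comp_apply, creation_apply, tmul_rep_one] using
    DFunLike.congr_fun hone k

variable [StarOrderedRing C]

lemma indRep_lip_tmul (hE : EquivalenceBimodule C A E) (hσ : ∀ h, IsNormalVector σ h)
    (e e' : E) (z : Z) (h : H) :
    indRep C Z σ (hE.lip e e') (tmul σ z h) = tmul σ (t e (ht.contract e' z)) h := by
  rw [indRep_tmul]
  refine ht.tmul_congr hσ (fun e'' x => ?_) h
  rw [ip_act_right, hE.star_lip, ← ht.act_left, hE.lip_smul, ht.balanced, ht.ip_tmul,
    ip_act_right, star_ip, ht.ip_contract]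

lemma ext_of_left (hE : EquivalenceBimodule C A E) (hσ : ∀ h, IsNormalVector σ h)
    (h : ∀ e x k, S (tmul σ (t e x) k) = T (tmul σ (t e x) k)) : S = T := by
  have hlip : ∀ e e' : E, S ∘L indRep C Z σ (hE.lip e e') = T ∘L indRep C Z σ (hE.lip e e') :=
    fun e e' => ind_ext σ fun z k => by
      rw [ContinuousLinearMap.comp_apply, ContinuousLinearMap.comp_apply,
        ht.indRep_lip_tmul hE hσ, h]
  have hone := comp_rep_one_eq hE.left_full (isNormalVector_indRep (A := C) (E := Z) hσ)
    (S := S) (T := T) (by rintro _ ⟨e, e', rfl⟩; exact DFunLike.congr_fun (hlip e e'))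
  rwa [indRep_one, ContinuousLinearMap.comp_id, ContinuousLinearMap.comp_id] at hone

end IsWStarTensor

variable [StarOrderedRing C] [StarOrderedRing A] (ht : IsWStarTensor C A B t) (σ)

lemma assocOp_act (c : C) (e : E) : assocOp ht σ (c • e) = indRep C Z σ c ∘L assocOp ht σ e :=
  ind_ext σ fun x h => by
    rw [assocOp_tmul, ContinuousLinearMap.comp_apply, assocOp_tmul, indRep_tmul, ht.act_left]

lemma assocIsom_tmul_eq_assocOp (e : E) (ξ : Ind X σ) :
    assocIsom ht σ (tmul (indRep A X σ) e ξ) = assocOp ht σ e ξ :=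
  indIsom_tmul (indRep A X σ) (assocOpBilin ht σ) _ e ξ

lemma assocIsom_comp_indRep (c : C) :
    assocIsom ht σ ∘L indRep C E (indRep A X σ) c = indRep C Z σ c ∘L assocIsom ht σ :=
  ind_ext _ fun e ξ => by
    simp only [ContinuousLinearMap.comp_apply, indRep_tmul, assocIsom_tmul_eq_assocOp,
      assocOp_act]

lemma adjoint_assocIsom_comp :
    adjoint (assocIsom ht σ) ∘L assocIsom ht σ = ContinuousLinearMap.id ℂ _ :=
  adjoint_indIsom_comp _ _ _

lemma assocIsom_adjoint_tmul (e : E) (x : X) (h : H) :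
    assocIsom ht σ (adjoint (assocIsom ht σ) (tmul σ (t e x) h)) = tmul σ (t e x) h := by
  rw [← assocIsom_tmul ht]
  exact congrArg _ (DFunLike.congr_fun (adjoint_assocIsom_comp σ ht) _)

variable {σ}

lemma isUnitaryIntertwiner_assocIsom_of_left (hE : EquivalenceBimodule C A E)
    (hσ : ∀ h, IsNormalVector σ h) :
    IsUnitaryIntertwiner (indRep C E (indRep A X σ)) (indRep C Z σ) (assocIsom ht σ) where
  adjoint_comp := adjoint_assocIsom_comp σ ht
  comp_adjoint := ht.ext_of_left hE hσ (assocIsom_adjoint_tmul σ ht)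
  comp_rep := assocIsom_comp_indRep σ ht

lemma isUnitaryIntertwiner_assocIsom_of_right (hX : EquivalenceBimodule A B X)
    (hσ : ∀ h, IsNormalVector σ h) :
    IsUnitaryIntertwiner (indRep C E (indRep A X σ)) (indRep C Z σ) (assocIsom ht σ) where
  adjoint_comp := adjoint_assocIsom_comp σ ht
  comp_adjoint := ht.ext_of_right hX hσ (assocIsom_adjoint_tmul σ ht)
  comp_rep := assocIsom_comp_indRep σ ht

end Tensor

section Iso

variable {A B Z₁ Z₂ H : Type*}
  [CStarAlgebra A] [PartialOrder A] [StarOrderedRing A]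
  [CStarAlgebra B] [PartialOrder B] [StarOrderedRing B]
  [NormedAddCommGroup Z₁] [NormedSpace ℂ Z₁] [Module A Z₁] [Module Bᵐᵒᵖ Z₁]
  [RightHilbertModule B Z₁] [WStarCorrespondence A B Z₁]
  [NormedAddCommGroup Z₂] [NormedSpace ℂ Z₂] [Module A Z₂] [Module Bᵐᵒᵖ Z₂]
  [RightHilbertModule B Z₂] [WStarCorrespondence A B Z₂]
  [NormedAddCommGroup H] [InnerProductSpace ℂ H] [CompleteSpace H]
  (W : CorrespondenceIso A B Z₁ Z₂) (σ : B →⋆ₙₐ[ℂ] (H →L[ℂ] H))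

omit [StarOrderedRing A] [WStarCorrespondence A B Z₁] [WStarCorrespondence A B Z₂] in
lemma isoTensorId_tmul (z : Z₁) (h : H) :
    isoTensorId W σ (tmul σ z h) = tmul σ (W.toFun z) h :=
  indIsom_tmul σ _ _ z h

omit [StarOrderedRing A] [WStarCorrespondence A B Z₁] [WStarCorrespondence A B Z₂] in
lemma adjoint_isoTensorId_comp :
    adjoint (isoTensorId W σ) ∘L isoTensorId W σ = ContinuousLinearMap.id ℂ _ :=
  adjoint_indIsom_comp _ _ _

lemma isUnitaryIntertwiner_isoTensorId :
    IsUnitaryIntertwiner (indRep A Z₁ σ) (indRep A Z₂ σ) (isoTensorId W σ) where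
  adjoint_comp := adjoint_isoTensorId_comp W σ
  comp_adjoint := ind_ext σ fun z h => by
    obtain ⟨y, rfl⟩ := W.toLinearEquiv.surjective z
    have hy := isoTensorId_tmul W σ y h
    exact hy ▸ congrArg _ (DFunLike.congr_fun (adjoint_isoTensorId_comp W σ) (tmul σ y h))
  comp_rep a := ind_ext _ fun z h => by
    simp only [ContinuousLinearMap.comp_apply, indRep_tmul, isoTensorId_tmul, W.map_act_left]

end Iso

/-! ### Inverting `T ↦ I_X ⊗ T` -/

section Inverse

variable {A B X H K : Type*}
  [CStarAlgebra A] [PartialOrder A] [StarOrderedRing A]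
  [CStarAlgebra B] [PartialOrder B] [StarOrderedRing B]
  [NormedAddCommGroup X] [NormedSpace ℂ X] [Module A X] [Module Bᵐᵒᵖ X]
  [RightHilbertModule B X] [WStarCorrespondence A B X]
  [NormedAddCommGroup H] [InnerProductSpace ℂ H] [CompleteSpace H]
  [NormedAddCommGroup K] [InnerProductSpace ℂ K] [CompleteSpace K]
  (hX : EquivalenceBimodule A B X)

section ConjTensor

variable (σ : B →⋆ₙₐ[ℂ] (H →L[ℂ] H))

lemma indRep_lip (x y : X) :
    indRep A X σ (hX.lip x y) = creation σ x ∘L adjoint (creation σ y) :=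
  ind_ext σ fun z h => by
    rw [indRep_tmul, hX.lip_smul, tmul_op_smul, ContinuousLinearMap.comp_apply,
      adjoint_creation_tmul, creation_apply]

lemma inner_adjoint_creation (x y : X) (ξ ζ : Ind X σ) :
    inner ℂ (adjoint (creation σ x) ξ) (adjoint (creation σ y) ζ) =
      inner ℂ ξ (indRep A X σ (hX.lip x y) ζ) := by
  rw [ContinuousLinearMap.adjoint_inner_left, indRep_lip, ContinuousLinearMap.comp_apply]

/-- The bilinear map `x̃, y ⊗ h ↦ σ(⟨x, y⟩) h` on `X̃ × (X ⊗_σ H)`. -/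
def conjTensorBilin : hX.Conj →ₗ[ℂ] Ind X σ →ₗ[ℂ] H :=
  LinearMap.mk₂ ℂ (fun x ξ => adjoint (creation σ (hX.toConj.symm x)) ξ)
    (fun x y ξ => ext_inner_left ℂ fun h => by
      simp only [map_add, inner_add_right, ContinuousLinearMap.adjoint_inner_right,
        creation_apply, tmul_add_left, inner_add_left])
    (fun c x ξ => ext_inner_left ℂ fun h => by
      simp only [LinearEquiv.map_smulₛₗ, inner_smul_right, ContinuousLinearMap.adjoint_inner_right,
        creation_apply, tmul_smul_left, inner_smul_left, Complex.conj_conj])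
    (fun x => map_add _)
    (fun c x => map_smul _ c)

/-- The canonical isometry `X̃ ⊗ (X ⊗_σ H) → H`, `x̃ ⊗ (y ⊗ h) ↦ σ(⟨x, y⟩) h`. -/
def conjTensorIsom : Ind hX.Conj (indRep A X σ) →L[ℂ] H :=
  indIsom (indRep A X σ) (conjTensorBilin hX σ) fun x ξ y ζ =>
    inner_adjoint_creation hX σ (hX.toConj.symm x) (hX.toConj.symm y) ξ ζ

lemma conjTensorIsom_tmul (x : X) (ξ : Ind X σ) :
    conjTensorIsom hX σ (tmul (indRep A X σ) (hX.toConj x) ξ) = adjoint (creation σ x) ξ :=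
  indIsom_tmul _ _ _ _ _

lemma adjoint_conjTensorIsom_comp :
    adjoint (conjTensorIsom hX σ) ∘L conjTensorIsom hX σ = ContinuousLinearMap.id ℂ _ :=
  adjoint_indIsom_comp _ _ _

lemma norm_conjTensorIsom_le : ‖conjTensorIsom hX σ‖ ≤ 1 :=
  norm_indLift_le _ _ zero_le_one _

lemma adjoint_conjTensorIsom_rep_ip (x y : X) (h : H) :
    adjoint (conjTensorIsom hX σ) (σ (ip x y) h) =
      tmul (indRep A X σ) (hX.toConj x) (tmul σ y h) := by
  rw [← adjoint_creation_tmul, ← conjTensorIsom_tmul hX]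
  exact DFunLike.congr_fun (adjoint_conjTensorIsom_comp hX σ) _

lemma rep_one_comp_conjTensorIsom : σ 1 ∘L conjTensorIsom hX σ = conjTensorIsom hX σ :=
  ind_ext _ fun x ξ => by
    obtain ⟨x, rfl⟩ := hX.toConj.surjective x
    rw [ContinuousLinearMap.comp_apply, conjTensorIsom_tmul, ← ContinuousLinearMap.comp_apply,
      ← adjoint_creation_op_smul_star, star_one, MulOpposite.op_one, one_smul]

lemma adjoint_conjTensorIsom_comp_rep_one :
    adjoint (conjTensorIsom hX σ) ∘L σ 1 = adjoint (conjTensorIsom hX σ) := by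
  have h := congrArg adjoint (rep_one_comp_conjTensorIsom hX σ)
  rwa [ContinuousLinearMap.adjoint_comp, ← ContinuousLinearMap.star_eq_adjoint (σ 1), ← map_star,
    star_one] at h

end ConjTensor

variable {σ : B →⋆ₙₐ[ℂ] (H →L[ℂ] H)} {ρ : B →⋆ₙₐ[ℂ] (K →L[ℂ] K)}

section

variable (T : Ind X ρ →L[ℂ] Ind X σ) (hT : ∀ a, T ∘L indRep A X ρ a = indRep A X σ a ∘L T)

/-- The operator `K → H` that corresponds to `I_X̃ ⊗ T : X̃ ⊗ (X ⊗_ρ K) → X̃ ⊗ (X ⊗_σ H)` under the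
canonical isometries of these spaces into `K` and `H`. -/
def indMapInv : K →L[ℂ] H :=
  conjTensorIsom hX σ ∘L indMap hX.Conj T hT ∘L adjoint (conjTensorIsom hX ρ)

lemma norm_indMapInv_le : ‖indMapInv hX T hT‖ ≤ ‖T‖ := by
  have hρ : ‖adjoint (conjTensorIsom hX ρ)‖ ≤ 1 :=
    (LinearIsometryEquiv.norm_map _ _).trans_le (norm_conjTensorIsom_le hX ρ)
  calc ‖indMapInv hX T hT‖
      ≤ ‖conjTensorIsom hX σ‖ * (‖indMap hX.Conj T hT‖ * ‖adjoint (conjTensorIsom hX ρ)‖) :=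
        (ContinuousLinearMap.opNorm_comp_le _ _).trans
          (by gcongr; exact ContinuousLinearMap.opNorm_comp_le _ _)
    _ ≤ 1 * (‖T‖ * 1) := by
        gcongr
        exacts [norm_conjTensorIsom_le hX σ, norm_indMap_le T hT]
    _ = ‖T‖ := by ring

lemma indMapInv_rep_ip (x y : X) (k : K) :
    indMapInv hX T hT (ρ (ip x y) k) = adjoint (creation σ x) (T (tmul ρ y k)) := by
  simp only [indMapInv, ContinuousLinearMap.comp_apply, adjoint_conjTensorIsom_rep_ip, indMap_tmul,
    conjTensorIsom_tmul]

lemma indMapInv_comp_rep_one : indMapInv hX T hT ∘L ρ 1 = indMapInv hX T hT := by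
  simp only [indMapInv, ContinuousLinearMap.comp_assoc, adjoint_conjTensorIsom_comp_rep_one]

lemma indMapInv_comp_rep (hρ : ∀ k, IsNormalVector ρ k) (b : B) :
    indMapInv hX T hT ∘L ρ b = σ b ∘L indMapInv hX T hT := by
  have h := comp_rep_one_eq hX.right_full hρ (S := indMapInv hX T hT ∘L ρ b)
    (T := σ b ∘L indMapInv hX T hT) <| by
      rintro _ ⟨x, y, rfl⟩ k
      have hb : ρ b (ρ (ip x y) k) = ρ (ip (x <• star b) y) k := by
        rw [ip_op_smul_left, star_star, map_mul, mul_apply_eq_comp]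
      simp only [ContinuousLinearMap.comp_apply, hb, indMapInv_rep_ip,
        adjoint_creation_op_smul_star]
  rwa [ContinuousLinearMap.comp_assoc, ContinuousLinearMap.comp_assoc, indMapInv_comp_rep_one,
    ← ContinuousLinearMap.mul_def, ← map_mul, mul_one] at h

lemma indMap_indMapInv (hρ : ∀ k, IsNormalVector ρ k) :
    indMap X (indMapInv hX T hT) (indMapInv_comp_rep hX T hT hρ) = T := by
  refine ind_ext ρ fun z k => ?_
  have h := comp_rep_one_eq hX.right_full hρ (S := creation σ z ∘L indMapInv hX T hT)
    (T := T ∘L creation ρ z) <| by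
      rintro _ ⟨x, y, rfl⟩ k
      calc creation σ z (indMapInv hX T hT (ρ (ip x y) k))
          = indRep A X σ (hX.lip z x) (T (tmul ρ y k)) := by
            rw [indMapInv_rep_ip, indRep_lip, ContinuousLinearMap.comp_apply]
        _ = T (indRep A X ρ (hX.lip z x) (tmul ρ y k)) :=
            (DFunLike.congr_fun (hT _) _).symm
        _ = T (creation ρ z (ρ (ip x y) k)) := by
            rw [indRep_tmul, hX.lip_smul, tmul_op_smul, creation_apply]
  rw [ContinuousLinearMap.comp_assoc, indMapInv_comp_rep_one] at h
  rw [indMap_tmul, ← creation_apply, ← ContinuousLinearMap.comp_apply, h]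
  simp only [ContinuousLinearMap.comp_apply, creation_apply, tmul_rep_one]

end

lemma indMapInv_indMap (hρ : ∀ k, IsNormalVector ρ k) (η : K →L[ℂ] H)
    (hη : ∀ b, η ∘L ρ b = σ b ∘L η) :
    indMapInv hX (indMap X η hη) (indMap_comp_indRep η hη) = η ∘L ρ 1 := by
  rw [← indMapInv_comp_rep_one]
  refine comp_rep_one_eq hX.right_full hρ ?_
  rintro _ ⟨x, y, rfl⟩ k
  rw [indMapInv_rep_ip, indMap_tmul, adjoint_creation_tmul]
  exact (DFunLike.congr_fun (hη _) k).symm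

include hX in
lemma norm_indMap (hρ : ∀ k, IsNormalVector ρ k) (hρ₁ : ρ 1 = ContinuousLinearMap.id ℂ K)
    (η : K →L[ℂ] H) (hη : ∀ b, η ∘L ρ b = σ b ∘L η) :
    ‖indMap X η hη‖ = ‖η‖ := by
  refine le_antisymm (norm_indMap_le η hη) ?_
  have h := norm_indMapInv_le hX (indMap X η hη) (indMap_comp_indRep η hη)
  rwa [indMapInv_indMap hX hρ, hρ₁, ContinuousLinearMap.comp_id] at h

end Inverse

/-! ### Disc categories -/

section Disc

variable {V V₂ : Type*} [NormedAddCommGroup V] [NormedSpace ℂ V]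
  [NormedAddCommGroup V₂] [NormedSpace ℂ V₂] (Φ : V ≃ₗᵢ[ℂ] V₂)

/-- The bijection of open unit discs given by an isometric isomorphism. -/
def discEquiv : Disc V ≃ Disc V₂ where
  toFun p := ⟨Φ p, by rw [mem_ball_zero_iff, Φ.norm_map]; exact mem_ball_zero_iff.mp p.2⟩
  invFun p := ⟨Φ.symm p, by
    rw [mem_ball_zero_iff, Φ.symm.norm_map]; exact mem_ball_zero_iff.mp p.2⟩
  left_inv p := Subtype.ext (Φ.symm_apply_apply p)
  right_inv p := Subtype.ext (Φ.apply_symm_apply p)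

lemma isHolomorphic_conj {g : Disc V → Disc V} (hg : IsHolomorphic g) :
    IsHolomorphic (discEquiv Φ ∘ g ∘ (discEquiv Φ).symm) := by
  obtain ⟨G, hG, hGg⟩ := hg
  refine ⟨Φ ∘ G ∘ Φ.symm, ?_, fun p => congrArg Φ (hGg ((discEquiv Φ).symm p))⟩
  refine Φ.differentiable.comp_differentiableOn
    (hG.comp Φ.symm.differentiable.differentiableOn fun v hv => ?_)
  rwa [mem_ball_zero_iff, Φ.symm.norm_map, ← mem_ball_zero_iff]

/-- Conjugation of disc automorphisms by an isometric isomorphism. -/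
def conjAut : discAut V ≃ discAut V₂ where
  toFun g := ⟨(discEquiv Φ).permCongr g.1, isHolomorphic_conj Φ g.2.1, isHolomorphic_conj Φ g.2.2⟩
  invFun g := ⟨(discEquiv Φ.symm).permCongr g.1, isHolomorphic_conj Φ.symm g.2.1,
    isHolomorphic_conj Φ.symm g.2.2⟩
  left_inv g := Subtype.ext ((discEquiv Φ).permCongr.symm_apply_apply g.1)
  right_inv g := Subtype.ext ((discEquiv Φ).permCongr.apply_symm_apply g.1)

lemma conjAut_apply (g : discAut V) (p : Disc V) :
    (conjAut Φ g).1 (discEquiv Φ p) = discEquiv Φ (g.1 p) :=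
  congrArg (fun q => discEquiv Φ (g.1 q)) ((discEquiv Φ).symm_apply_apply p)

/-- The functor between disc categories given by an isometric isomorphism. -/
def discFunctor : DiscCat V ⥤ DiscCat V₂ where
  obj p := ⟨discEquiv Φ p.pt⟩
  map {p q} g := ⟨conjAut Φ g.aut, by rw [conjAut_apply, g.map_pt]⟩
  map_id p := DiscCat.Hom.ext (Subtype.ext (discEquiv Φ).permCongr_refl)
  map_comp {p q r} g h :=
    DiscCat.Hom.ext (Subtype.ext ((discEquiv Φ).permCongr_trans g.aut.1 h.aut.1).symm)

instance : (discFunctor Φ).Faithful where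
  map_injective hgh :=
    DiscCat.Hom.ext ((conjAut Φ).injective (congrArg DiscCat.Hom.aut hgh))

instance : (discFunctor Φ).Full where
  map_surjective {p q} g := by
    obtain ⟨f, hf⟩ := (conjAut Φ).surjective g.aut
    refine ⟨⟨f, (discEquiv Φ).injective ?_⟩, DiscCat.Hom.ext hf⟩
    rw [← conjAut_apply, hf]
    exact g.map_pt

instance : (discFunctor Φ).EssSurj where
  mem_essImage p := ⟨⟨(discEquiv Φ).symm p.pt⟩,
    ⟨eqToIso (congrArg DiscCat.mk ((discEquiv Φ).apply_symm_apply p.pt))⟩⟩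

instance : (discFunctor Φ).IsEquivalence where

end Disc

/-! ### The transform is an isometric isomorphism -/

section Transform

variable {A B E F X Z₁ Z₂ H : Type*}
  [CStarAlgebra A] [PartialOrder A] [StarOrderedRing A]
  [CStarAlgebra B] [PartialOrder B] [StarOrderedRing B]
  [NormedAddCommGroup E] [NormedSpace ℂ E] [Module A E] [Module Aᵐᵒᵖ E]
  [RightHilbertModule A E] [WStarCorrespondence A A E]
  [NormedAddCommGroup F] [NormedSpace ℂ F] [Module B F] [Module Bᵐᵒᵖ F]
  [RightHilbertModule B F] [WStarCorrespondence B B F]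
  [NormedAddCommGroup X] [NormedSpace ℂ X] [Module A X] [Module Bᵐᵒᵖ X]
  [RightHilbertModule B X] [WStarCorrespondence A B X]
  [NormedAddCommGroup Z₁] [NormedSpace ℂ Z₁] [Module A Z₁] [Module Bᵐᵒᵖ Z₁]
  [RightHilbertModule B Z₁] [WStarCorrespondence A B Z₁]
  [NormedAddCommGroup Z₂] [NormedSpace ℂ Z₂] [Module A Z₂] [Module Bᵐᵒᵖ Z₂]
  [RightHilbertModule B Z₂] [WStarCorrespondence A B Z₂]
  [NormedAddCommGroup H] [InnerProductSpace ℂ H] [CompleteSpace H]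
  {t₁ : E →ₗ[ℂ] X →ₗ[ℂ] Z₁} (ht₁ : IsWStarTensor A A B t₁)
  {t₂ : X →ₗ[ℂ] F →ₗ[ℂ] Z₂} (ht₂ : IsWStarTensor A B B t₂)
  (W : CorrespondenceIso A B Z₁ Z₂) {σ : B →⋆ₙₐ[ℂ] (H →L[ℂ] H)}

variable (σ) in
/-- The operator `W ⊗ I_H`, with the canonical identifications regarded as an operator from
`E ⊗ (X ⊗_σ H)` to `X ⊗ (F ⊗_σ H)`. -/
def transport : Ind E (indRep A X σ) →L[ℂ] Ind X (indRep B F σ) :=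
  adjoint (assocIsom ht₂ σ) ∘L isoTensorId W σ ∘L assocIsom ht₁ σ

lemma intertwiners_comp (η : intertwiners F σ) (b : B) :
    η.1 ∘L indRep B F σ b = σ b ∘L η.1 := η.2 b

lemma transform_eq (η : intertwiners F σ) :
    transform ht₁ ht₂ W σ η = indMap X η.1 (intertwiners_comp η) ∘L transport ht₁ ht₂ W σ := rfl

lemma transform_add (η ζ : intertwiners F σ) :
    transform ht₁ ht₂ W σ (η + ζ) = transform ht₁ ht₂ W σ η + transform ht₁ ht₂ W σ ζ :=
  (congrArg (· ∘L transport ht₁ ht₂ W σ) (indMap_add (intertwiners_comp η)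
    (intertwiners_comp ζ) (intertwiners_comp (η + ζ)))).trans
    (ContinuousLinearMap.add_comp _ _ _)

lemma transform_smul (c : ℂ) (η : intertwiners F σ) :
    transform ht₁ ht₂ W σ (c • η) = c • transform ht₁ ht₂ W σ η :=
  (congrArg (· ∘L transport ht₁ ht₂ W σ) (indMap_smul c (intertwiners_comp η)
    (intertwiners_comp (c • η)))).trans
    (ContinuousLinearMap.smul_comp _ _ _)

variable (hX : EquivalenceBimodule A B X) (hσ : ∀ h, IsNormalVector σ h)
include hX hσ

lemma isUnitaryIntertwiner_transport :
    IsUnitaryIntertwiner (indRep A E (indRep A X σ)) (indRep A X (indRep B F σ))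
      (transport ht₁ ht₂ W σ) :=
  (isUnitaryIntertwiner_assocIsom_of_left ht₂ hX hσ).symm.comp
    ((isUnitaryIntertwiner_isoTensorId W σ).comp
      (isUnitaryIntertwiner_assocIsom_of_right ht₁ hX hσ))

lemma norm_transform (η : intertwiners F σ) : ‖transform ht₁ ht₂ W σ η‖ = ‖η‖ := by
  rw [transform_eq, (isUnitaryIntertwiner_transport ht₁ ht₂ W hX hσ).norm_comp_eq]
  exact norm_indMap hX (isNormalVector_indRep hσ) (indRep_one σ) η.1 (intertwiners_comp η)

lemma transform_mem_intertwiners (η : intertwiners F σ) :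
    transform ht₁ ht₂ W σ η ∈ intertwiners E (indRep A X σ) := fun a => by
  rw [transform_eq, ContinuousLinearMap.comp_assoc,
    (isUnitaryIntertwiner_transport ht₁ ht₂ W hX hσ).comp_rep, ← ContinuousLinearMap.comp_assoc,
    indMap_comp_indRep, ContinuousLinearMap.comp_assoc]

lemma exists_transform_eq (S : intertwiners E (indRep A X σ)) :
    ∃ η : intertwiners F σ, transform ht₁ ht₂ W σ η = S.1 := by
  have hU := isUnitaryIntertwiner_transport ht₁ ht₂ W hX hσ
  have hT : ∀ a, (S.1 ∘L adjoint (transport ht₁ ht₂ W σ)) ∘L indRep A X (indRep B F σ) a =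
      indRep A X σ a ∘L S.1 ∘L adjoint (transport ht₁ ht₂ W σ) := fun a => by
    rw [ContinuousLinearMap.comp_assoc, hU.symm.comp_rep, ← ContinuousLinearMap.comp_assoc, S.2 a,
      ContinuousLinearMap.comp_assoc]
  have hρ : ∀ ξ, IsNormalVector (indRep B F σ) ξ := isNormalVector_indRep hσ
  refine ⟨⟨indMapInv hX _ hT, indMapInv_comp_rep hX _ hT hρ⟩, ?_⟩
  rw [transform_eq, indMap_indMapInv hX _ hT hρ, ContinuousLinearMap.comp_assoc, hU.adjoint_comp,
    ContinuousLinearMap.comp_id]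

omit hX hσ in
/-- The transform `η ↦ (I_X ⊗ η)(W ⊗ I_H)` as an isometric isomorphism of intertwiner spaces. -/
def transformEquiv (hX : EquivalenceBimodule A B X) (hσ : ∀ h, IsNormalVector σ h) :
    intertwiners F σ ≃ₗᵢ[ℂ] intertwiners E (indRep A X σ) :=
  LinearIsometryEquiv.ofSurjective
    { toFun := fun η => ⟨transform ht₁ ht₂ W σ η, transform_mem_intertwiners ht₁ ht₂ W hX hσ η⟩
      map_add' := fun η ζ => Subtype.ext (transform_add ht₁ ht₂ W η ζ)
      map_smul' := fun c η => Subtype.ext (transform_smul ht₁ ht₂ W c η)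
      norm_map' := norm_transform ht₁ ht₂ W hX hσ }
    fun S => (exists_transform_eq ht₁ ht₂ W hX hσ S).imp fun _ h => Subtype.ext h

end Transform

end WStarMorita

end

open WStarMorita CategoryTheory in
theorem mainTheorem5_general {A B E F X Z₁ Z₂ H : Type*}
    [CStarAlgebra A] [PartialOrder A] [StarOrderedRing A]
    [CStarAlgebra B] [PartialOrder B] [StarOrderedRing B]
    [NormedAddCommGroup E] [NormedSpace ℂ E] [Module A E] [Module Aᵐᵒᵖ E]
    [RightHilbertModule A E] [WStarCorrespondence A A E]
    [NormedAddCommGroup F] [NormedSpace ℂ F] [Module B F] [Module Bᵐᵒᵖ F]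
    [RightHilbertModule B F] [WStarCorrespondence B B F]
    [NormedAddCommGroup X] [NormedSpace ℂ X] [Module A X] [Module Bᵐᵒᵖ X]
    [RightHilbertModule B X] [WStarCorrespondence A B X] (hX : EquivalenceBimodule A B X)
    [NormedAddCommGroup Z₁] [NormedSpace ℂ Z₁] [Module A Z₁] [Module Bᵐᵒᵖ Z₁]
    [RightHilbertModule B Z₁] [WStarCorrespondence A B Z₁]
    (t₁ : E →ₗ[ℂ] X →ₗ[ℂ] Z₁) (ht₁ : IsWStarTensor A A B t₁)
    [NormedAddCommGroup Z₂] [NormedSpace ℂ Z₂] [Module A Z₂] [Module Bᵐᵒᵖ Z₂]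
    [RightHilbertModule B Z₂] [WStarCorrespondence A B Z₂]
    (t₂ : X →ₗ[ℂ] F →ₗ[ℂ] Z₂) (ht₂ : IsWStarTensor A B B t₂)
    (W : CorrespondenceIso A B Z₁ Z₂)
    [NormedAddCommGroup H] [InnerProductSpace ℂ H] [CompleteSpace H]
    (σ : B →⋆ₙₐ[ℂ] (H →L[ℂ] H)) (hσ : ScottContinuous σ) :
    ∃ e : Covrep F σ ≌ Covrep E (indRep A X σ),
      (∀ η : Covrep F σ,
        ((e.functor.obj η).pt.1 : Ind E (indRep A X σ) →L[ℂ] Ind X σ) =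
          transform ht₁ ht₂ W σ η.pt.1) ∧
      ∀ (η₁ η₂ : Covrep F σ) (g : η₁ ⟶ η₂) (ζ : Covrep F σ),
        (e.functor.map g).aut.1 (e.functor.obj ζ).pt =
          (e.functor.obj ⟨g.aut.1 ζ.pt⟩).pt := by
  have hσ' : ∀ h, IsNormalVector σ h := isNormalVector_of_scottContinuous hσ
  exact ⟨(discFunctor (transformEquiv ht₁ ht₂ W hX hσ')).asEquivalence, fun _ => rfl,
    fun _ _ g ζ => conjAut_apply _ g.aut ζ.pt⟩

open WStarMorita CategoryTheory in
/-- Let `(E, A)` and `(F, B)` be W⋆-correspondences that are weakly Morita equivalent via the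
W⋆-equivalence bimodule `X` and the isomorphism `W : E ⊗ X → X ⊗ F` (W⋆-tensor products), and let
`σ` be a normal representation of `B` on `H`. Then `η^* ↦ (I_X ⊗ η^*)(W ⊗ I_H)` is the object map
of an equivalence of categories from `σ-Covrep F` to `σ^X-Covrep E`, which maps an automorphism
`g` to the automorphism `(I_X ⊗ ζ^*)(W ⊗ I_H) ↦ (I_X ⊗ g(ζ^*))(W ⊗ I_H)`. -/
theorem mainTheorem5 {A B E F X Z₁ Z₂ H : Type*}
    [CStarAlgebra A] [PartialOrder A] [StarOrderedRing A] [WStarAlgebra A]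
    [CStarAlgebra B] [PartialOrder B] [StarOrderedRing B] [WStarAlgebra B]
    [NormedAddCommGroup E] [NormedSpace ℂ E] [Module A E] [Module Aᵐᵒᵖ E]
    [RightHilbertModule A E] [WStarCorrespondence A A E]
    [NormedAddCommGroup F] [NormedSpace ℂ F] [Module B F] [Module Bᵐᵒᵖ F]
    [RightHilbertModule B F] [WStarCorrespondence B B F]
    [NormedAddCommGroup X] [NormedSpace ℂ X] [Module A X] [Module Bᵐᵒᵖ X]
    [RightHilbertModule B X] [WStarCorrespondence A B X] (_hX : EquivalenceBimodule A B X)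
    [NormedAddCommGroup Z₁] [NormedSpace ℂ Z₁] [Module A Z₁] [Module Bᵐᵒᵖ Z₁]
    [RightHilbertModule B Z₁] [WStarCorrespondence A B Z₁]
    (t₁ : E →ₗ[ℂ] X →ₗ[ℂ] Z₁) (ht₁ : IsWStarTensor A A B t₁)
    [NormedAddCommGroup Z₂] [NormedSpace ℂ Z₂] [Module A Z₂] [Module Bᵐᵒᵖ Z₂]
    [RightHilbertModule B Z₂] [WStarCorrespondence A B Z₂]
    (t₂ : X →ₗ[ℂ] F →ₗ[ℂ] Z₂) (ht₂ : IsWStarTensor A B B t₂)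
    (W : CorrespondenceIso A B Z₁ Z₂)
    [NormedAddCommGroup H] [InnerProductSpace ℂ H] [CompleteSpace H]
    (σ : B →⋆ₙₐ[ℂ] (H →L[ℂ] H)) (_hσ : ScottContinuous σ) :
    ∃ e : Covrep F σ ≌ Covrep E (indRep A X σ),
      (∀ η : Covrep F σ,
        ((e.functor.obj η).pt.1 : Ind E (indRep A X σ) →L[ℂ] Ind X σ) =
          transform ht₁ ht₂ W σ η.pt.1) ∧
      ∀ (η₁ η₂ : Covrep F σ) (g : η₁ ⟶ η₂) (ζ : Covrep F σ),
        (e.functor.map g).aut.1 (e.functor.obj ζ).pt =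
          (e.functor.obj ⟨g.aut.1 ζ.pt⟩).pt :=
  mainTheorem5_general _hX t₁ ht₁ t₂ ht₂ W σ _hσ
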